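/- Let $d\ge 1$ and let $\Omega\subset\mathbb R^d$ be a bounded connected open set with Lipschitz boundary. Let $K\subset\mathbb R^d$ be a compact set that is the closure of a nonempty connected open set, has a boundary of zero measure, and satisfies $(k+K)\cap K=\emptyset$ for all $k\in\mathbb Z^d\setminus\{0\}$. Put $E=\bigcup_{k\in\mathbb Z^d}(k+K)$ and $D=\inf\{r:\ E+B_{r/2}\text{ is connected}\}$, where $B_{r/2}$ is the open ball of radius $r/2$ centred at $0$. Let $\varphi_0:[0,\infty)\to[0,\infty)$ be non-increasing and such that $\varphi(\xi)=\varphi_0(|\xi|)$ satisfies $\int_{\mathbb R^d}\varphi(\xi)(1+|\xi|^2)\,d\xi<\infty$; let $\varphi_\varepsilon(\xi)=\varepsilon^{-d}\varphi(\xi/\varepsilon)$ and, for $u\in L^2(\Omega)$, $$F_{\delta,\varepsilon}(u)=\frac1{\varepsilon^2}\int_{(\Omega\cap\delta E)\times(\Omega\cap\delta E)}\varphi_\varepsilon(x-y)\,|u(x)-u(y)|^2\,dx\,dy .$$ Let $\delta=\delta_\varepsilon>0$ be such that, as $\varepsilon\to0^+$, $\delta_\varepsilon\to0$ and $\varepsilon/\delta_\varepsilon\to\kappa\in(0,\infty)$.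 Suppose that either the support of $\varphi_0$ is $[0,1]$ and $\kappa>D$, or the support of $\varphi$ is the whole $\mathbb R^d$. Let $u_\varepsilon\in L^2(\Omega)$ ($\varepsilon>0$) be such that $F_{\delta_\varepsilon,\varepsilon}(u_\varepsilon)$ is bounded uniformly for all sufficiently small $\varepsilon>0$. For $k\in\mathbb Z^d$ with $\delta_\varepsilon(k+K)\subset\Omega$ let $$u^\varepsilon_k=\frac1{\delta_\varepsilon^d|K|}\int_{\delta_\varepsilon(k+K)}u_\varepsilon(y)\,dy ,$$ and let $u^\varepsilon_k=0$ for all other $k$ (on a given compact subset of $\Omega$ these values play no role when $\varepsilon$ is small). Let $\overline u_\varepsilon$ be the piecewise-affine interpolation of $\delta_\varepsilon k\mapsto u^\varepsilon_k$ on Kuhn's decomposition of the cubes $\delta_\varepsilon(k+[0,1]^d)$; that is, for each $k\in\mathbb Z^d$ and each permutation $\sigma$ of $\{1,\dots,d\}$, $\overline u_\varepsilon$ is affine on the simplex with vertices $\delta_\varepsilon(k+e_{\sigma(1)}+\dots+e_{\sigma(j)})$, $j=0,\dots,d$, and it equals $u^\varepsilon_m$ at $\delta_\varepsilon m$ for every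 $m\in\mathbb Z^d$. Then for every sequence $\varepsilon_n\to0^+$: (i) there exist a subsequence $\varepsilon_{n_j}$, constants $c_j\in\mathbb R$ and a function $u\in H^1(\Omega)$ such that $\overline u_{\varepsilon_{n_j}}+c_j\to u$ in $L^2_{\rm loc}(\Omega)$; (ii) if $c_n\in\mathbb R$ and $\overline u_{\varepsilon_n}+c_n\to w$ in $L^2_{\rm loc}(\Omega)$, then $w\in H^1(\Omega)$. -/

import Mathlib

open MeasureTheory Filter Topology Set
open scoped NNReal ENNReal Pointwise RealInnerProductSpace

noncomputable section

/-- The integer vector `k ∈ ℤ^d`, seen as a point of `ℝ^d`. -/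
def latticePoint {d : ℕ} (k : Fin d → ℤ) : EuclideanSpace ℝ (Fin d) :=
  WithLp.toLp 2 (fun i => (k i : ℝ))

/-- The `1`-periodic set `E = ⋃ₖ (k + K)`. -/
def periodicSet {d : ℕ} (K : Set (EuclideanSpace ℝ (Fin d))) : Set (EuclideanSpace ℝ (Fin d)) :=
  ⋃ k : Fin d → ℤ, (latticePoint k +ᵥ K)

/-- The inclusion `δ (k + K)`. -/
def inclusion {d : ℕ} (K : Set (EuclideanSpace ℝ (Fin d))) (δ : ℝ) (k : Fin d → ℤ) :
    Set (EuclideanSpace ℝ (Fin d)) :=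
  δ • (latticePoint k +ᵥ K)

/-- Admissible inclusions at unit scale: `K` is compact, is the closure of a (nonempty) connected
open set, has a boundary of zero measure, and is disjoint from its nontrivial integer
translates. -/
structure IsInclusionShape {d : ℕ} (K : Set (EuclideanSpace ℝ (Fin d))) : Prop where
  isCompact : IsCompact K
  eq_closure : ∃ U : Set (EuclideanSpace ℝ (Fin d)), IsOpen U ∧ IsConnected U ∧ K = closure U
  volume_frontier : volume (frontier K) = 0
  disjoint_translate : ∀ k : Fin d → ℤ, k ≠ 0 → Disjoint (latticePoint k +ᵥ K) K

/-- `D = inf {r : E + B_{r/2} is connected}`. The ball is open, hence empty for `r ≤ 0`, and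
`IsConnected` includes nonemptiness, so only `r > 0` counts. -/
def connectionDistance {d : ℕ} (K : Set (EuclideanSpace ℝ (Fin d))) : ℝ :=
  sInf {r : ℝ | IsConnected
    (periodicSet K + Metric.ball (0 : EuclideanSpace ℝ (Fin d)) (r / 2))}

/-- The radial kernel `φ(ξ) = φ₀(|ξ|)`. -/
def radialKernel (d : ℕ) (φ₀ : ℝ≥0 → ℝ≥0) (ξ : EuclideanSpace ℝ (Fin d)) : ℝ :=
  (φ₀ ‖ξ‖₊ : ℝ)

/-- The scaled kernel `φ_ε(ξ) = ε^{-d} φ(ξ / ε)`. -/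
def scaledKernel (d : ℕ) (φ₀ : ℝ≥0 → ℝ≥0) (ε : ℝ) (ξ : EuclideanSpace ℝ (Fin d)) : ℝ :=
  (ε ^ d)⁻¹ * radialKernel d φ₀ (ε⁻¹ • ξ)

/-- The energy `F_{δ,ε}(u) = ε⁻² ∫_{(Ω ∩ δE) × (Ω ∩ δE)} φ_ε(x - y) |u(x) - u(y)|² dx dy`,
as an integral of a nonnegative function with values in `[0, ∞]`. -/
def energy {d : ℕ} (Ω K : Set (EuclideanSpace ℝ (Fin d))) (φ₀ : ℝ≥0 → ℝ≥0) (δ ε : ℝ)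
    (u : EuclideanSpace ℝ (Fin d) → ℝ) : ℝ≥0∞ :=
  ENNReal.ofReal (ε ^ 2)⁻¹ *
    ∫⁻ p : EuclideanSpace ℝ (Fin d) × EuclideanSpace ℝ (Fin d) in
      (Ω ∩ δ • periodicSet K) ×ˢ (Ω ∩ δ • periodicSet K),
      ENNReal.ofReal (scaledKernel d φ₀ ε (p.1 - p.2) * |u p.1 - u p.2| ^ 2)

open Classical in
/-- The average `u_k` of `u` on `δ (k + K)`, for the `k` with `δ (k + K) ⊆ Ω`. At all other nodes
the value is set to `0`; on a fixed compact subset of `Ω` the interpolation below does not see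
these nodes as soon as `δ` is small. -/
def inclusionMean {d : ℕ} (Ω K : Set (EuclideanSpace ℝ (Fin d))) (δ : ℝ)
    (u : EuclideanSpace ℝ (Fin d) → ℝ) (k : Fin d → ℤ) : ℝ :=
  if inclusion K δ k ⊆ Ω then
    (δ ^ d * volume.real K)⁻¹ * ∫ x in inclusion K δ k, u x
  else 0

/-- The vertices `e_{σ(0)} + ⋯ + e_{σ(j-1)}`, `j = 0, …, d`, of the simplex
`{1 ≥ t_{σ(0)} ≥ ⋯ ≥ t_{σ(d-1)} ≥ 0}` of Kuhn's decomposition of the unit cube. -/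
def kuhnVertex {d : ℕ} (σ : Equiv.Perm (Fin d)) (j : ℕ) : Fin d → ℤ :=
  fun i => if (σ.symm i : ℕ) < j then 1 else 0

/-- The affine function on the Kuhn simplex of `σ`, translated by `k`, that takes the value
`v (k + w)` at each vertex `w` of the simplex. -/
def kuhnAffine {d : ℕ} (v : (Fin d → ℤ) → ℝ) (k : Fin d → ℤ) (σ : Equiv.Perm (Fin d))
    (t : Fin d → ℝ) : ℝ :=
  v k + ∑ j : Fin d, t (σ j) * (v (k + kuhnVertex σ (j + 1)) - v (k + kuhnVertex σ j))

/-- The piecewise-affine interpolation, on Kuhn's decomposition of the cubes `δ (k + [0,1]^d)`, of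
the function `δ k ↦ v k`. Writing `x = δ (k + t)` with `k ∈ ℤ^d` and `t ∈ [0,1)^d`, the permutation
sorts the coordinates of `t` in decreasing order, so that `t` lies in its simplex. -/
def kuhnInterpolation {d : ℕ} (δ : ℝ) (v : (Fin d → ℤ) → ℝ) (x : EuclideanSpace ℝ (Fin d)) : ℝ :=
  kuhnAffine v (fun i => ⌊x i / δ⌋) (Tuple.sort fun i => -Int.fract (x i / δ))
    (fun i => Int.fract (x i / δ))

/-- `Ω` has a Lipschitz boundary: near each boundary point it is, in suitable orthonormal
coordinates, the strict epigraph of a Lipschitz function. Here `ν` is the vertical direction, and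
`γ` is a function on the hyperplane orthogonal to `ν`. -/
def HasLipschitzBoundary {d : ℕ} (Ω : Set (EuclideanSpace ℝ (Fin d))) : Prop :=
  ∀ x ∈ frontier Ω, ∃ (ν : EuclideanSpace ℝ (Fin d)) (γ : (ℝ ∙ ν)ᗮ → ℝ) (L : ℝ≥0) (r : ℝ),
    ‖ν‖ = 1 ∧ LipschitzWith L γ ∧ 0 < r ∧
      ∀ y ∈ Metric.ball x r, (y ∈ Ω ↔ γ ((ℝ ∙ ν)ᗮ.orthogonalProjectionOnto y) < ⟪ν, y⟫)

/-- `u ∈ H¹(Ω)`: `u ∈ L²(Ω)`, and `u` has a weak gradient in `L²(Ω; ℝ^d)`. -/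
def MemH1 {d : ℕ} (Ω : Set (EuclideanSpace ℝ (Fin d))) (u : EuclideanSpace ℝ (Fin d) → ℝ) : Prop :=
  MemLp u 2 (volume.restrict Ω) ∧
    ∃ G : EuclideanSpace ℝ (Fin d) → EuclideanSpace ℝ (Fin d), MemLp G 2 (volume.restrict Ω) ∧
      ∀ ψ : EuclideanSpace ℝ (Fin d) → ℝ, ContDiff ℝ (⊤ : ℕ∞) ψ → HasCompactSupport ψ →
        tsupport ψ ⊆ Ω → ∀ i : Fin d,
          ∫ x in Ω, u x * fderiv ℝ ψ x (EuclideanSpace.single i 1) = -∫ x in Ω, G x i * ψ x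

/-- `wₙ → w` in `L²_loc(Ω)`, where `w ∈ L²_loc(Ω)`. -/
def TendstoL2Loc {d : ℕ} (Ω : Set (EuclideanSpace ℝ (Fin d)))
    (w : ℕ → EuclideanSpace ℝ (Fin d) → ℝ) (w₀ : EuclideanSpace ℝ (Fin d) → ℝ) : Prop :=
  ∀ C : Set (EuclideanSpace ℝ (Fin d)), IsCompact C → C ⊆ Ω →
    MemLp w₀ 2 (volume.restrict C) ∧
      Tendsto (fun n => eLpNorm (fun x => w n x - w₀ x) 2 (volume.restrict C)) atTop (𝓝 0)

end

/-! Everything follows from one discrete estimate: the squared differences between the means over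
neighbouring inclusions, integrated over the points at distance of order `δ` or more from the
complement of `Ω`, are `O(δ²)` (`exists_eventually_lintegral_localOsc_le`). No extension operator is
needed.

The assumption on the support gives radii `r < ρ` such that the `r/2`-neighbourhood of the periodic
set is connected and the scaled kernel is bounded below at distances less than `ρδ`. Cut the
inclusions into pieces of small diameter. By connectedness any two pieces are joined by a chain in
which all points of consecutive pieces are less than `ρ` apart, so each link is part of the energy.
The pieces have positive measure, so links compose by averaging the triangle inequality over the
intermediate piece (`controlled_vadd`). Jensen's inequality then passes to the means, and `ε ~ κδ`
turns the bounded energy into the power `δ²`.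

The estimate says that the piecewise-constant interpolation moves by `O(δ)` in `L²` under shifts of
length at most `δ`. Telescoping (`sqInt_shift_le`) gives `O(|z| + δ)` for a shift `z`. Hence double
integrals of squared differences over balls are bounded; connectedness of `Ω` lets one additive
constant per index serve all of `Ω`, and approximation by functions constant on small cells gives
finite nets, that is, compactness in `L²_loc` (`exists_tendstoL2Loc`). A limit has increments
`O(|z|)`, so difference quotients and Riesz representation give its weak gradient, while inward
translation at the Lipschitz boundary makes it square integrable on all of `Ω`
(`ShiftLipschitz.memH1`).

The affine and the constant interpolation differ by `O(δ)` in `L²_loc`, so they have the same limits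
(`tendstoL2Loc_kuhnInterpolation_iff`). -/

/-- Euclidean space `ℝ^d`. -/
abbrev Euc (d : ℕ) : Type := EuclideanSpace ℝ (Fin d)

/-! ### Squared `L²` norms, shifts and double integrals. -/

/-- The square of the `L²(A)` norm, as an extended nonnegative number. -/
noncomputable def sqInt {d : ℕ} (A : Set (Euc d)) (f : Euc d → ℝ) : ℝ≥0∞ :=
  ∫⁻ x in A, ENNReal.ofReal (f x ^ 2)

section SqInt

variable {d : ℕ} {A B : Set (Euc d)} {f g h : Euc d → ℝ}

theorem sqInt_mono_set (h : A ⊆ B) : sqInt A f ≤ sqInt B f := lintegral_mono_set h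

theorem sqInt_congr_set (hA : MeasurableSet A) (h : ∀ x ∈ A, f x = g x) :
    sqInt A f = sqInt A g :=
  setLIntegral_congr_fun hA fun x hx => by rw [h x hx]

theorem ofReal_sq_add_le (a b : ℝ) :
    ENNReal.ofReal ((a + b) ^ 2) ≤ 2 * ENNReal.ofReal (a ^ 2) + 2 * ENNReal.ofReal (b ^ 2) := by
  rw [← ENNReal.ofReal_ofNat 2, ← ENNReal.ofReal_mul (by norm_num),
    ← ENNReal.ofReal_mul (by norm_num), ← ENNReal.ofReal_add (by positivity) (by positivity)]
  exact ENNReal.ofReal_le_ofReal (by nlinarith [sq_nonneg (a - b)])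

theorem AEMeasurable.ofReal_sq {α : Type*} [MeasurableSpace α] {μ : Measure α} {f : α → ℝ}
    (hf : AEMeasurable f μ) : AEMeasurable (fun x => ENNReal.ofReal (f x ^ 2)) μ :=
  (hf.pow_const 2).ennreal_ofReal

/-- Measurability of one summand is enough to split the upper integral; this matters for shifted
limit functions, whose measurability is not at hand. -/
theorem sqInt_le_add (hf : AEMeasurable f (volume.restrict A)) (hh : ∀ x, h x = f x + g x) :
    sqInt A h ≤ 2 * sqInt A f + 2 * sqInt A g := by
  unfold sqInt
  rw [← lintegral_const_mul'' _ hf.ofReal_sq, ← lintegral_const_mul' _ _ (by simp),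
    ← lintegral_add_left' (hf.ofReal_sq.const_mul _)]
  exact lintegral_mono fun x => by rw [hh x]; exact ofReal_sq_add_le _ _

theorem sqInt_sub_comm : sqInt A (fun x => f x - g x) = sqInt A (fun x => g x - f x) := by
  simp [sqInt, sub_sq_comm]

theorem sqInt_const (c : ℝ) : sqInt A (fun _ => c) = ENNReal.ofReal (c ^ 2) * volume A := by
  simp [sqInt]

theorem lintegral_image_add_right (F : Euc d → ℝ≥0∞) (A : Set (Euc d)) (z : Euc d) :
    ∫⁻ x in A, F (x + z) = ∫⁻ x in (fun x => x + z) '' A, F x :=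
  (measurePreserving_add_right volume z).setLIntegral_comp_emb
    (measurableEmbedding_addRight z) F A

theorem sqInt_comp_add_right (f : Euc d → ℝ) (A : Set (Euc d)) (z : Euc d) :
    sqInt A (fun x => f (x + z)) = sqInt ((fun x => x + z) '' A) f :=
  lintegral_image_add_right (fun x => ENNReal.ofReal (f x ^ 2)) A z

theorem eLpNorm_two_eq (f : Euc d → ℝ) (A : Set (Euc d)) :
    eLpNorm f 2 (volume.restrict A) = sqInt A f ^ (1 / 2 : ℝ) := by
  rw [eLpNorm_eq_lintegral_rpow_enorm_toReal (by simp) (by simp)]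
  simp only [ENNReal.toReal_ofNat, sqInt]
  congr 1
  refine lintegral_congr fun x => ?_
  rw [Real.enorm_eq_ofReal_abs, ← sq_abs, ENNReal.ofReal_pow (abs_nonneg _)]
  norm_cast

theorem sqInt_eq_eLpNorm_sq (f : Euc d → ℝ) (A : Set (Euc d)) :
    sqInt A f = eLpNorm f 2 (volume.restrict A) ^ 2 := by
  rw [eLpNorm_two_eq, ← ENNReal.rpow_natCast, ← ENNReal.rpow_mul]
  norm_num

theorem memLp_two_iff_sqInt (hf : AEStronglyMeasurable f (volume.restrict A)) :
    MemLp f 2 (volume.restrict A) ↔ sqInt A f < ∞ := by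
  rw [sqInt_eq_eLpNorm_sq, ENNReal.pow_lt_top_iff]
  simp [MemLp, hf]

theorem tendsto_eLpNorm_two_iff {ι : Type*} {l : Filter ι} (F : ι → Euc d → ℝ) :
    Tendsto (fun n => eLpNorm (F n) 2 (volume.restrict A)) l (𝓝 0) ↔
      Tendsto (fun n => sqInt A (F n)) l (𝓝 0) := by
  constructor
  · intro h
    simp_rw [sqInt_eq_eLpNorm_sq]
    have := ((ENNReal.continuous_pow 2).tendsto 0).comp h
    simpa [Function.comp_def] using this
  · intro h
    simp_rw [eLpNorm_two_eq]
    have := (ENNReal.continuous_rpow_const (y := 1 / 2)).tendsto 0 |>.comp h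
    simpa [Function.comp_def] using this

/-- Telescoping along a segment: an `L²` bound for small shifts gives one for all shifts. -/
theorem sqInt_shift_le {O : Set (Euc d)} {δ : ℝ} {C : ℝ≥0} (hδ : 0 < δ) (hg : Measurable g)
    (hS : ∀ s, ‖s‖ ≤ δ → sqInt O (fun y => g (y + s) - g y) ≤ C * ENNReal.ofReal (δ ^ 2))
    {z : Euc d} (hA : ∀ x ∈ A, ∀ t ∈ Icc (0 : ℝ) 1, x + t • z ∈ O) :
    sqInt A (fun x => g (x + z) - g x) ≤ C * ENNReal.ofReal ((‖z‖ + δ) ^ 2) := by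
  -- With this `N`, the step `z / N` has length at most `δ` and `N * δ ≤ ‖z‖ + δ`. Cauchy–Schwarz
  -- costs a factor `N` on a sum of `N` terms, hence the bound `C (N δ)²`.
  set N : ℕ := ⌊‖z‖ / δ⌋₊ + 1 with hN
  have hN0 : (0 : ℝ) < N := by positivity
  have hN1 : ‖z‖ / δ < N := by simpa [hN] using Nat.lt_floor_add_one (‖z‖ / δ)
  have hN2 : N * δ ≤ ‖z‖ + δ := by
    have := Nat.floor_le (div_nonneg (norm_nonneg z) hδ.le)
    rw [le_div_iff₀ hδ] at this
    push_cast [hN]; linarith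
  set s : Euc d := (N : ℝ)⁻¹ • z with hs
  have hs1 : ‖s‖ ≤ δ := by
    rw [hs, norm_smul, norm_inv, Real.norm_natCast, inv_mul_le_iff₀ hN0]
    rw [div_lt_iff₀ hδ] at hN1
    exact hN1.le
  have hz : (N : ℝ) • s = z := by rw [hs, smul_smul, mul_inv_cancel₀ hN0.ne', one_smul]
  have hterm : ∀ j ∈ Finset.range N,
      ∫⁻ x in A, ENNReal.ofReal ((g (x + ((j + 1 : ℕ) : ℝ) • s) - g (x + (j : ℝ) • s)) ^ 2) ≤
        C * ENNReal.ofReal (δ ^ 2) := by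
    intro j hj
    have h1 := lintegral_image_add_right
      (fun y => ENNReal.ofReal ((g (y + s) - g y) ^ 2)) A ((j : ℝ) • s)
    have h2 : ∀ x, x + ((j + 1 : ℕ) : ℝ) • s = x + (j : ℝ) • s + s := fun x => by
      push_cast; rw [add_smul, one_smul, add_assoc]
    simp_rw [h2]
    rw [h1]
    refine (lintegral_mono_set ?_).trans (hS s hs1)
    rintro _ ⟨x, hx, rfl⟩
    have := hA x hx (j * (N : ℝ)⁻¹) ⟨by positivity, ?_⟩
    · rwa [mul_smul] at this
    · rw [← div_eq_mul_inv, div_le_one hN0]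
      exact_mod_cast (Finset.mem_range.1 hj).le
  have hpt : ∀ x, ENNReal.ofReal ((g (x + z) - g x) ^ 2) ≤ N * ∑ j ∈ Finset.range N,
      ENNReal.ofReal ((g (x + ((j + 1 : ℕ) : ℝ) • s) - g (x + (j : ℝ) • s)) ^ 2) := by
    intro x
    have h1 : g (x + z) - g x =
        ∑ j ∈ Finset.range N, (g (x + ((j + 1 : ℕ) : ℝ) • s) - g (x + (j : ℝ) • s)) := by
      rw [Finset.sum_range_sub (fun j => g (x + (j : ℝ) • s)) N, hz]
      simp
    rw [h1, ← ENNReal.ofReal_natCast, ← ENNReal.ofReal_sum_of_nonneg (fun _ _ => sq_nonneg _),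
      ← ENNReal.ofReal_mul hN0.le]
    refine ENNReal.ofReal_le_ofReal ?_
    simpa using sq_sum_le_card_mul_sum_sq (s := Finset.range N)
      (f := fun j : ℕ => g (x + ((j + 1 : ℕ) : ℝ) • s) - g (x + (j : ℝ) • s))
  calc sqInt A (fun x => g (x + z) - g x)
      ≤ ∫⁻ x in A, N * ∑ j ∈ Finset.range N,
        ENNReal.ofReal ((g (x + ((j + 1 : ℕ) : ℝ) • s) - g (x + (j : ℝ) • s)) ^ 2) :=
        lintegral_mono hpt
    _ = N * ∑ j ∈ Finset.range N, ∫⁻ x in A,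
        ENNReal.ofReal ((g (x + ((j + 1 : ℕ) : ℝ) • s) - g (x + (j : ℝ) • s)) ^ 2) := by
        rw [lintegral_const_mul' _ _ (by simp), lintegral_finsetSum]
        intro j _
        fun_prop
    _ ≤ N * ∑ j ∈ Finset.range N, C * ENNReal.ofReal (δ ^ 2) := by
        gcongr with j hj; exact hterm j hj
    _ = C * ENNReal.ofReal ((N * δ) ^ 2) := by
        rw [Finset.sum_const, Finset.card_range, nsmul_eq_mul, mul_pow,
          ENNReal.ofReal_mul (by positivity), ENNReal.ofReal_pow hN0.le, ENNReal.ofReal_natCast]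
        ring
    _ ≤ C * ENNReal.ofReal ((‖z‖ + δ) ^ 2) := by gcongr

/-- The double integral of squared differences over pairs at distance at most `ρ`. -/
theorem lintegral_closedBall_sq_sub_le {O : Set (Euc d)} {δ ρ : ℝ} {C : ℝ≥0} (hδ : 0 < δ)
    (hg : Measurable g)
    (hS : ∀ s, ‖s‖ ≤ δ → sqInt O (fun y => g (y + s) - g y) ≤ C * ENNReal.ofReal (δ ^ 2))
    (hA : ∀ x ∈ A, Metric.closedBall x ρ ⊆ O) :
    ∫⁻ x in A, ∫⁻ y in Metric.closedBall x ρ, ENNReal.ofReal ((g x - g y) ^ 2) ≤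
      volume (Metric.closedBall (0 : Euc d) ρ) * (C * ENNReal.ofReal ((ρ + δ) ^ 2)) := by
  have h1 : ∀ x, ∫⁻ y in Metric.closedBall x ρ, ENNReal.ofReal ((g x - g y) ^ 2) =
      ∫⁻ z in Metric.closedBall (0 : Euc d) ρ, ENNReal.ofReal ((g (x + z) - g x) ^ 2) := by
    intro x
    have := lintegral_image_add_right
      (fun y => ENNReal.ofReal ((g x - g y) ^ 2)) (Metric.closedBall (0 : Euc d) ρ) x
    have him : (fun y => y + x) '' Metric.closedBall (0 : Euc d) ρ = Metric.closedBall x ρ := by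
      rw [Set.image_add_right]
      ext y
      simp [dist_eq_norm, sub_eq_add_neg]
    rw [him] at this
    rw [← this]
    simp only [add_comm x, sub_sq_comm (g x)]
  simp_rw [h1]
  -- After substituting `y = x + z` and swapping, the inner integral is the squared increment for a
  -- fixed shift `z`.
  rw [lintegral_lintegral_swap (by fun_prop)]
  calc _ ≤ ∫⁻ z in Metric.closedBall (0 : Euc d) ρ, C * ENNReal.ofReal ((ρ + δ) ^ 2) := by
        refine setLIntegral_mono' Metric.isClosed_closedBall.measurableSet fun z hz => ?_
        have hz' : ‖z‖ ≤ ρ := by simpa using hz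
        refine (sqInt_shift_le (A := A) hδ hg hS fun x hx t ht => hA x hx ?_).trans ?_
        · simp only [Metric.mem_closedBall, dist_self_add_left, norm_smul, Real.norm_eq_abs,
            abs_of_nonneg ht.1]
          exact (mul_le_of_le_one_left (norm_nonneg z) ht.2).trans hz'
        · gcongr
    _ = _ := by simp [mul_comm]

/-- Take for `a` a value `g y` at a point where `∫_B |g x - g y|² dx` does not exceed its average
over `y`. This replaces the mean value and needs no integrability of `g`. -/
theorem exists_const_sqInt_le (hB : volume B ≠ 0) (hB' : volume B ≠ ∞) (hg : Measurable g) :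
    ∃ a : ℝ, volume B * sqInt B (fun x => g x - a) ≤
      ∫⁻ x in B, ∫⁻ y in B, ENNReal.ofReal ((g x - g y) ^ 2) := by
  have hm : Measurable fun y => ∫⁻ x in B, ENNReal.ofReal ((g x - g y) ^ 2) :=
    Measurable.lintegral_prod_left' (f := fun p : Euc d × Euc d =>
      ENNReal.ofReal ((g p.1 - g p.2) ^ 2)) (by fun_prop)
  obtain ⟨y, -, hy⟩ := exists_le_setLAverage hB hB' hm.aemeasurable
  refine ⟨g y, ?_⟩
  rw [setLAverage_eq, ENNReal.le_div_iff_mul_le (Or.inl hB) (Or.inl hB'), mul_comm] at hy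
  refine hy.trans ?_
  rw [lintegral_lintegral_swap (by fun_prop)]

/-- Integrate `|g x|² ≤ 2 |g x - g y|² + 2 |g y|²` over `x ∈ A` and `y ∈ B`: a bound on `B` spreads
to `A` through the double integral. -/
theorem volume_mul_sqInt_le (hg : Measurable g) :
    volume B * sqInt A g ≤ 2 * (∫⁻ x in A, ∫⁻ y in B, ENNReal.ofReal ((g x - g y) ^ 2)) +
      2 * (volume A * sqInt B g) := by
  have hm : Measurable fun x => ∫⁻ y in B, ENNReal.ofReal ((g x - g y) ^ 2) :=
    Measurable.lintegral_prod_right' (f := fun p : Euc d × Euc d =>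
      ENNReal.ofReal ((g p.1 - g p.2) ^ 2)) (by fun_prop)
  calc volume B * sqInt A g = ∫⁻ x in A, ∫⁻ y in B, ENNReal.ofReal (g x ^ 2) := by
        simp only [setLIntegral_const, sqInt]
        rw [lintegral_mul_const _ (by fun_prop), mul_comm]
    _ ≤ ∫⁻ x in A, (2 * (∫⁻ y in B, ENNReal.ofReal ((g x - g y) ^ 2)) + 2 * sqInt B g) := by
        refine lintegral_mono fun x => ?_
        rw [sqInt, ← lintegral_const_mul _ (by fun_prop), ← lintegral_const_mul _ (by fun_prop),
          ← lintegral_add_left (by fun_prop)]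
        refine lintegral_mono fun y => ?_
        simpa using ofReal_sq_add_le (g x - g y) (g y)
    _ = _ := by
        rw [lintegral_add_right _ measurable_const, lintegral_const_mul _ hm, setLIntegral_const]
        ring

end SqInt

/-! ### Sequences with small increments: local boundedness. -/

/-- A sequence whose increments over shifts of length at most `δ n` are of order `δ n` in `L²`, at
distance `R * δ n` from the complement of `Ω`. -/
structure ShiftBounded {d : ℕ} (Ω : Set (Euc d)) (δ : ℕ → ℝ) (R : ℝ) (C : ℝ≥0)
    (g : ℕ → Euc d → ℝ) : Prop where
  pos : ∀ n, 0 < δ n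
  tendsto : Tendsto δ atTop (𝓝 0)
  measurable : ∀ n, Measurable (g n)
  bound : ∀ n s, ‖s‖ ≤ δ n →
    sqInt {y | Metric.ball y (R * δ n) ⊆ Ω} (fun y => g n (y + s) - g n y) ≤
      C * ENNReal.ofReal (δ n ^ 2)

namespace ShiftBounded

variable {d : ℕ} {Ω : Set (Euc d)} {δ : ℕ → ℝ} {R : ℝ} {C : ℝ≥0} {g : ℕ → Euc d → ℝ}

theorem add_const (hg : ShiftBounded Ω δ R C g) (c : ℕ → ℝ) :
    ShiftBounded Ω δ R C fun n x => g n x + c n where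
  pos := hg.pos
  tendsto := hg.tendsto
  measurable n := (hg.measurable n).add_const _
  bound n s hs := by simpa using hg.bound n s hs

theorem eventually_subset (hg : ShiftBounded Ω δ R C g) (hΩ : IsOpen Ω) {D : Set (Euc d)}
    (hD : IsCompact D) (hDΩ : D ⊆ Ω) :
    ∀ᶠ n in atTop, D ⊆ {y | Metric.ball y (R * δ n) ⊆ Ω} := by
  obtain ⟨η, hη, h⟩ := hD.exists_thickening_subset_open hΩ hDΩ
  have h0 : Tendsto (fun n => R * δ n) atTop (𝓝 0) := by simpa using hg.tendsto.const_mul R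
  filter_upwards [h0.eventually_lt_const hη] with n hn y hy
  exact (Metric.ball_subset_ball hn.le).trans ((Metric.ball_subset_thickening hy η).trans h)

/-- Two points of the ball are less than `2ρ` apart, and balls of radius `2ρ` around its points stay
in the ball of radius `3ρ`; eventually `δ n < 1`, which makes the bound independent of `n`. -/
theorem eventually_lintegral_ball_le (hg : ShiftBounded Ω δ R C g) (hΩ : IsOpen Ω) {x : Euc d}
    {ρ : ℝ} (hx : Metric.closedBall x (3 * ρ) ⊆ Ω) :
    ∀ᶠ n in atTop, ∫⁻ y in Metric.ball x ρ, ∫⁻ z in Metric.ball x ρ,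
      ENNReal.ofReal ((g n y - g n z) ^ 2) ≤
        volume (Metric.closedBall (0 : Euc d) (2 * ρ)) *
          (C * ENNReal.ofReal ((2 * ρ + 1) ^ 2)) := by
  rcases le_or_gt ρ 0 with hρ | hρ
  · simp [Metric.ball_eq_empty.2 hρ]
  filter_upwards [hg.eventually_subset hΩ (isCompact_closedBall x (3 * ρ)) hx,
    hg.tendsto.eventually_lt_const one_pos] with n hn hn1
  have hball : ∀ y ∈ Metric.ball x ρ, Metric.closedBall y (2 * ρ) ⊆ Metric.closedBall x (3 * ρ) := by
    intro y hy
    refine Metric.closedBall_subset_closedBall' ?_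
    linarith [Metric.mem_ball.1 hy]
  calc _ ≤ ∫⁻ y in Metric.ball x ρ, ∫⁻ z in Metric.closedBall y (2 * ρ),
        ENNReal.ofReal ((g n y - g n z) ^ 2) := by
        refine setLIntegral_mono' Metric.isOpen_ball.measurableSet fun y hy => ?_
        refine lintegral_mono_set fun z hz => ?_
        rw [Metric.mem_closedBall]
        rw [Metric.mem_ball] at hy hz
        linarith [dist_triangle_right z y x]
    _ ≤ _ := lintegral_closedBall_sq_sub_le (hg.pos n) (hg.measurable n) (hg.bound n)
        fun y hy => (hball y hy).trans hn
    _ ≤ _ := by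
        have := (hg.pos n).le
        gcongr

/-- The sequence is bounded in `L²` near `x`. -/
def BoundedNear (g : ℕ → Euc d → ℝ) (x : Euc d) : Prop :=
  ∃ ρ > 0, ∃ B : ℝ≥0, ∀ᶠ n in atTop, sqInt (Metric.ball x ρ) (g n) ≤ B

theorem BoundedNear.of_mem_ball {x y : Euc d} {ρ : ℝ} {B : ℝ≥0}
    (h : ∀ᶠ n in atTop, sqInt (Metric.ball x ρ) (g n) ≤ B) (hy : y ∈ Metric.ball x ρ) :
    BoundedNear g y := by
  obtain ⟨r, hr, hrs⟩ := Metric.isOpen_iff.1 Metric.isOpen_ball y hy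
  exact ⟨r, hr, B, h.mono fun n hn => (sqInt_mono_set hrs).trans hn⟩

/-- A bound on a small ball around `y` spreads to the whole ball around `x` by
`volume_mul_sqInt_le`. The radius depends on `x` only, so failure of local boundedness is an open
condition as well. -/
theorem boundedNear_of_mem_ball (hg : ShiftBounded Ω δ R C g) (hΩ : IsOpen Ω) {x y : Euc d}
    {ρ : ℝ} (hx : Metric.closedBall x (3 * ρ) ⊆ Ω) (hy : y ∈ Metric.ball x ρ)
    (h : BoundedNear g y) : BoundedNear g x := by
  obtain ⟨r, hr, B, hB⟩ := h
  obtain ⟨r', hr', hrs⟩ := Metric.isOpen_iff.1 Metric.isOpen_ball y hy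
  set s := min r r'
  have hs : 0 < s := lt_min hr hr'
  have hρ : 0 < ρ := dist_nonneg.trans_lt (Metric.mem_ball.1 hy)
  have hpos : volume (Metric.ball y s) ≠ 0 := (Metric.measure_ball_pos _ _ hs).ne'
  have hfin : volume (Metric.ball y s) ≠ ∞ := measure_ball_lt_top.ne
  set X : ℝ≥0∞ := (2 * (volume (Metric.closedBall (0 : Euc d) (2 * ρ)) *
    (C * ENNReal.ofReal ((2 * ρ + 1) ^ 2))) + 2 * (volume (Metric.ball x ρ) * B)) /
      volume (Metric.ball y s) with hX
  have hXt : X ≠ ∞ := by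
    refine ENNReal.div_ne_top ?_ hpos
    have h1 : volume (Metric.closedBall (0 : Euc d) (2 * ρ)) ≠ ∞ := measure_closedBall_lt_top.ne
    have h2 : volume (Metric.ball x ρ) ≠ ∞ := measure_ball_lt_top.ne
    finiteness
  refine ⟨ρ, hρ, X.toNNReal, ?_⟩
  filter_upwards [hB, hg.eventually_lintegral_ball_le hΩ hx] with n hn hn'
  rw [ENNReal.coe_toNNReal hXt, hX, ENNReal.le_div_iff_mul_le (Or.inl hpos) (Or.inl hfin), mul_comm]
  refine (volume_mul_sqInt_le (hg.measurable n)).trans ?_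
  gcongr
  · refine (lintegral_mono fun z => lintegral_mono_set ?_).trans hn'
    exact (Metric.ball_subset_ball (min_le_right _ _)).trans hrs
  · exact (sqInt_mono_set (Metric.ball_subset_ball (min_le_left _ _))).trans hn

/-- After subtracting suitable constants, the sequence is bounded in `L²` near each point. -/
theorem exists_boundedNear (hg : ShiftBounded Ω δ R C g) (hΩ : IsOpen Ω) (hc : IsConnected Ω) :
    ∃ c : ℕ → ℝ, ∀ x ∈ Ω, BoundedNear (fun n x => g n x + c n) x := by
  have hball : ∀ x ∈ Ω, ∃ ρ > 0, Metric.closedBall x (3 * ρ) ⊆ Ω := by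
    intro x hx
    obtain ⟨r, hr, h⟩ := Metric.nhds_basis_closedBall.mem_iff.1 (hΩ.mem_nhds hx)
    exact ⟨r / 3, by positivity, by rwa [mul_div_cancel₀ _ (by norm_num : (3 : ℝ) ≠ 0)]⟩
  obtain ⟨x₀, hx₀⟩ := hc.nonempty
  obtain ⟨ρ, hρ, hx₀ρ⟩ := hball x₀ hx₀
  have hpos : volume (Metric.ball x₀ ρ) ≠ 0 := (Metric.measure_ball_pos _ _ hρ).ne'
  have hfin : volume (Metric.ball x₀ ρ) ≠ ∞ := measure_ball_lt_top.ne
  choose a ha using fun n => exists_const_sqInt_le hpos hfin (hg.measurable n)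
  have h0 : BoundedNear (fun n x => g n x + -a n) x₀ := by
    set X : ℝ≥0∞ := (volume (Metric.closedBall (0 : Euc d) (2 * ρ)) *
      (C * ENNReal.ofReal ((2 * ρ + 1) ^ 2))) / volume (Metric.ball x₀ ρ) with hX
    have hXt : X ≠ ∞ := by
      refine ENNReal.div_ne_top ?_ hpos
      have h1 : volume (Metric.closedBall (0 : Euc d) (2 * ρ)) ≠ ∞ := measure_closedBall_lt_top.ne
      finiteness
    refine ⟨ρ, hρ, X.toNNReal, ?_⟩
    filter_upwards [hg.eventually_lintegral_ball_le hΩ hx₀ρ] with n hn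
    rw [ENNReal.coe_toNNReal hXt, hX, ENNReal.le_div_iff_mul_le (Or.inl hpos) (Or.inl hfin),
      mul_comm]
    exact (ha n).trans hn
  refine ⟨fun n => -a n, fun x hx => ?_⟩
  set h := fun n x => g n x + -a n
  have hh : ShiftBounded Ω δ R C h := hg.add_const _
  -- Local boundedness and its negation are both open in `Ω`, so by connectedness the bound near
  -- `x₀` holds near every point, with the same constants `a n`.
  refine (hc.isPreconnected.induction₂ (fun x y => BoundedNear h x ↔ BoundedNear h y) ?_
    (fun _ _ _ _ _ _ => Iff.trans) (fun _ _ _ _ => Iff.symm) hx₀ hx).1 h0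
  intro y hy
  obtain ⟨r, hr, hyr⟩ := hball y hy
  by_cases hb : BoundedNear h y
  · obtain ⟨s, hs, B, hB⟩ := hb
    filter_upwards [mem_nhdsWithin_of_mem_nhds (Metric.ball_mem_nhds y hs)] with z hz
    exact iff_of_true ⟨s, hs, B, hB⟩ (BoundedNear.of_mem_ball hB hz)
  · filter_upwards [mem_nhdsWithin_of_mem_nhds (Metric.ball_mem_nhds y hr)] with z hz
    exact iff_of_false hb fun hz' => hb (hh.boundedNear_of_mem_ball hΩ hyr hz hz')

theorem eventually_sqInt_le_of_isCompact (hb : ∀ x ∈ Ω, BoundedNear g x) {D : Set (Euc d)}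
    (hD : IsCompact D) (hDΩ : D ⊆ Ω) :
    ∃ B : ℝ≥0, ∀ᶠ n in atTop, sqInt D (g n) ≤ B := by
  refine hD.induction_on (p := fun s => ∃ B : ℝ≥0, ∀ᶠ n in atTop, sqInt s (g n) ≤ B) ?_ ?_ ?_ ?_
  · exact ⟨0, by simp [sqInt]⟩
  · rintro s t hst ⟨B, hB⟩
    exact ⟨B, hB.mono fun n hn => (sqInt_mono_set hst).trans hn⟩
  · rintro s t ⟨B, hB⟩ ⟨B', hB'⟩
    refine ⟨B + B', ?_⟩
    filter_upwards [hB, hB'] with n h1 h2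
    refine (lintegral_union_le _ _ _).trans ?_
    push_cast
    exact add_le_add h1 h2
  · intro x hx
    obtain ⟨ρ, hρ, B, hB⟩ := hb x (hDΩ hx)
    exact ⟨_, mem_nhdsWithin_of_mem_nhds (Metric.ball_mem_nhds x hρ), B, hB⟩

end ShiftBounded

/-! ### Lattice cells and finite nets. -/

/-- The index of the half-open lattice cube of side `ρ` that contains `x`. -/
noncomputable def cellIndex {d : ℕ} (ρ : ℝ) (x : Euc d) : Fin d → ℤ := fun i => ⌊x i / ρ⌋

/-- The half-open lattice cube of side `ρ` with index `k`. -/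
def cell {d : ℕ} (ρ : ℝ) (k : Fin d → ℤ) : Set (Euc d) := cellIndex ρ ⁻¹' {k}

section Cells

variable {d : ℕ} {ρ : ℝ}

theorem measurable_cellIndex (ρ : ℝ) : Measurable (cellIndex (d := d) ρ) := by
  unfold cellIndex
  fun_prop

theorem measurableSet_cell (ρ : ℝ) (k : Fin d → ℤ) : MeasurableSet (cell ρ k) :=
  measurable_cellIndex ρ (measurableSet_singleton k)

theorem measurable_comp_cellIndex (ρ : ℝ) {β : Type*} [MeasurableSpace β]
    (a : (Fin d → ℤ) → β) : Measurable fun x : Euc d => a (cellIndex ρ x) :=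
  (measurable_of_countable a).comp (measurable_cellIndex ρ)

theorem norm_le_of_forall_abs_le {z : Euc d} (hρ : 0 ≤ ρ) (h : ∀ i, |z i| ≤ ρ) :
    ‖z‖ ≤ d * ρ := by
  refine abs_le_of_sq_le_sq' ?_ (by positivity) |>.2
  rw [EuclideanSpace.norm_sq_eq]
  calc ∑ i, ‖z i‖ ^ 2 ≤ ∑ i : Fin d, ρ ^ 2 := by
        gcongr with i; exact h i
    _ = d * ρ ^ 2 := by simp
    _ ≤ (d * d : ℕ) * ρ ^ 2 := by
        gcongr; exact Nat.le_mul_self d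
    _ = (d * ρ) ^ 2 := by push_cast; ring

theorem dist_le_of_mem_cell (hρ : 0 < ρ) {k : Fin d → ℤ} {x y : Euc d} (hx : x ∈ cell ρ k)
    (hy : y ∈ cell ρ k) : dist x y ≤ d * ρ := by
  rw [dist_eq_norm]
  refine norm_le_of_forall_abs_le hρ.le fun i => ?_
  have h : ⌊x i / ρ⌋ = ⌊y i / ρ⌋ := congrFun (hx.trans hy.symm) i
  have := Int.abs_sub_lt_one_of_floor_eq_floor h
  rw [← sub_div, abs_div, abs_of_pos hρ, div_lt_one hρ] at this
  exact this.le

theorem volume_cell (hρ : 0 < ρ) (k : Fin d → ℤ) :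
    volume (cell ρ k) = ENNReal.ofReal ρ ^ d := by
  have h : cell ρ k = (WithLp.ofLp : Euc d → Fin d → ℝ) ⁻¹'
      Set.pi univ fun i => Ico (k i * ρ) (k i * ρ + ρ) := by
    ext x
    simp only [cell, cellIndex, mem_preimage, mem_singleton_iff, funext_iff, Set.mem_pi, mem_univ,
      true_implies, mem_Ico, Int.floor_eq_iff, le_div_iff₀ hρ, div_lt_iff₀ hρ, add_mul, one_mul]
  rw [h, (PiLp.volume_preserving_ofLp (Fin d)).measure_preimage
    (MeasurableSet.univ_pi fun _ => measurableSet_Ico).nullMeasurableSet, Real.volume_pi_Ico]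
  simp

theorem finite_cellIndex_image (hρ : 0 < ρ) {D : Set (Euc d)} (hD : Bornology.IsBounded D) :
    (cellIndex ρ '' D).Finite := by
  obtain ⟨M, hM⟩ := hD.exists_norm_le
  refine (Set.Finite.pi' (fun _ : Fin d => Set.finite_Icc ⌊-M / ρ⌋ ⌊M / ρ⌋)).subset ?_
  rintro _ ⟨x, hx, rfl⟩ i
  have h1 : |x i| ≤ M := (PiLp.norm_apply_le x i).trans (hM x hx)
  rw [abs_le] at h1
  exact ⟨Int.floor_le_floor (by gcongr; exact h1.1), Int.floor_le_floor (by gcongr; exact h1.2)⟩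

theorem sqInt_le_sum_cell {D : Set (Euc d)} {T : Finset (Fin d → ℤ)}
    (hT : ∀ x ∈ D, cellIndex ρ x ∈ T) (f : Euc d → ℝ) :
    sqInt D f ≤ ∑ k ∈ T, sqInt (cell ρ k) f := by
  refine (sqInt_mono_set (B := ⋃ k ∈ T, cell ρ k) fun x hx => ?_).trans ?_
  · simpa [cell] using hT x hx
  · unfold sqInt
    rw [lintegral_biUnion_finset _ fun k _ => measurableSet_cell ρ k]
    intro k _ l _ hkl
    exact Disjoint.preimage _ (by simpa using hkl)

theorem memLp_comp_cellIndex (hρ : 0 < ρ) {D : Set (Euc d)} (hD : Bornology.IsBounded D)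
    (a : (Fin d → ℤ) → ℝ) : MemLp (fun x => a (cellIndex ρ x)) 2 (volume.restrict D) := by
  have hfin := finite_cellIndex_image hρ hD
  have : IsFiniteMeasure (volume.restrict D) := ⟨by simpa using hD.measure_lt_top⟩
  obtain ⟨B, hB⟩ := (hfin.image fun k => ‖a k‖).bddAbove
  have hm := (measurable_comp_cellIndex (d := d) ρ a)
  refine MemLp.of_bound hm.aestronglyMeasurable B ?_
  refine (ae_restrict_iff (measurableSet_le hm.norm measurable_const)).2 (ae_of_all _ fun x hx => ?_)
  exact hB (mem_image_of_mem _ (mem_image_of_mem _ hx))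

end Cells

namespace ShiftBounded

variable {d : ℕ} {Ω : Set (Euc d)} {δ : ℕ → ℝ} {R : ℝ} {C : ℝ≥0} {g : ℕ → Euc d → ℝ}

/-- On a compact set, the sequence is approximated in `L²`, uniformly in `n`, by functions that are
constant on small cells and have uniformly bounded values. -/
theorem exists_cellwise_approx (hg : ShiftBounded Ω δ R C g) (hΩ : IsOpen Ω)
    (hb : ∀ x ∈ Ω, BoundedNear g x) {D : Set (Euc d)} (hD : IsCompact D) (hDΩ : D ⊆ Ω)
    {ε : ℝ≥0} (hε : 0 < ε) :
    ∃ ρ > 0, ∃ B : ℝ, ∀ᶠ n in atTop, ∃ a : (Fin d → ℤ) → ℝ, (∀ k, |a k| ≤ B) ∧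
      sqInt D (fun x => g n x - a (cellIndex ρ x)) ≤ ε := by
  obtain ⟨η, hη, hηΩ⟩ := hD.exists_cthickening_subset_open hΩ hDΩ
  set V : ℝ≥0 := (volume (Metric.ball (0 : Euc d) 1)).toNNReal with hV
  have hVe : (V : ℝ≥0∞) = volume (Metric.ball (0 : Euc d) 1) :=
    ENNReal.coe_toNNReal measure_ball_lt_top.ne
  -- the size of the cells
  obtain ⟨ρ, hρ, hρη, hρε⟩ : ∃ ρ > 0, 2 * (d * ρ) ≤ η ∧
      (d : ℝ) ^ d * V * C * (d * ρ + ρ) ^ 2 ≤ ε := by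
    have h1 : Tendsto (fun ρ : ℝ => 2 * (d * ρ)) (𝓝[>] 0) (𝓝 0) := by
      have : Continuous fun ρ : ℝ => 2 * (d * ρ) := by fun_prop
      simpa using (this.tendsto 0).mono_left nhdsWithin_le_nhds
    have h2 : Tendsto (fun ρ : ℝ => (d : ℝ) ^ d * V * C * (d * ρ + ρ) ^ 2) (𝓝[>] 0) (𝓝 0) := by
      have : Continuous fun ρ : ℝ => (d : ℝ) ^ d * V * C * (d * ρ + ρ) ^ 2 := by fun_prop
      simpa using (this.tendsto 0).mono_left nhdsWithin_le_nhds
    obtain ⟨ρ, h⟩ := ((h1.eventually_le_const hη).and ((h2.eventually_le_const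
      (NNReal.coe_pos.2 hε)).and self_mem_nhdsWithin)).exists
    exact ⟨ρ, h.2.2, h.1, h.2.1⟩
  have hdρ : (0 : ℝ) ≤ d * ρ := by positivity
  set D' := Metric.cthickening (d * ρ) D
  set D'' := Metric.cthickening (2 * (d * ρ)) D
  have hD'' : IsCompact D'' := hD.cthickening
  have hD''Ω : D'' ⊆ Ω := (Metric.cthickening_mono hρη D).trans hηΩ
  have hD' : IsCompact D' := hD.cthickening
  have hD'D'' : D' ⊆ D'' := Metric.cthickening_mono (by linarith) D
  have hD'ball : ∀ x ∈ D', Metric.closedBall x (d * ρ) ⊆ D'' := by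
    intro x hx
    refine (Metric.closedBall_subset_cthickening hx _).trans ?_
    refine (Metric.cthickening_cthickening_subset hdρ hdρ D).trans_eq ?_
    rw [← two_mul]
  have hfin := finite_cellIndex_image hρ hD.isBounded
  set T := hfin.toFinset with hT
  have hTD : ∀ x ∈ D, cellIndex ρ x ∈ T := fun x hx => by
    rw [hT, Set.Finite.mem_toFinset]; exact mem_image_of_mem _ hx
  have hcell : ∀ k ∈ T, cell ρ k ⊆ D' := by
    intro k hk y hy
    rw [hT, Set.Finite.mem_toFinset] at hk
    obtain ⟨x, hx, rfl⟩ := hk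
    exact Metric.mem_cthickening_of_dist_le _ x _ _ hx (dist_le_of_mem_cell hρ hy rfl)
  set v := ENNReal.ofReal ρ ^ d with hv
  have hv0 : v ≠ 0 := by simp [hv, hρ]
  have hvt : v ≠ ∞ := by simp [hv]
  obtain ⟨B', hB'⟩ := eventually_sqInt_le_of_isCompact hb hD' (hD'D''.trans hD''Ω)
  -- the double integrals over the cells
  have key : ∀ᶠ n in atTop, ∑ k ∈ T, ∫⁻ x in cell ρ k, ∫⁻ y in cell ρ k,
      ENNReal.ofReal ((g n x - g n y) ^ 2) ≤ v * ε := by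
    filter_upwards [hg.eventually_subset hΩ hD'' hD''Ω, hg.tendsto.eventually_le_const hρ]
      with n hn hn1
    calc _ ≤ ∑ k ∈ T, ∫⁻ x in cell ρ k, ∫⁻ y in Metric.closedBall x (d * ρ),
          ENNReal.ofReal ((g n x - g n y) ^ 2) := by
          refine Finset.sum_le_sum fun k _ => ?_
          refine setLIntegral_mono' (measurableSet_cell ρ k) fun x hx => lintegral_mono_set ?_
          exact fun y hy => dist_le_of_mem_cell hρ hy hx
      _ = ∫⁻ x in ⋃ k ∈ T, cell ρ k, ∫⁻ y in Metric.closedBall x (d * ρ),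
          ENNReal.ofReal ((g n x - g n y) ^ 2) := by
          rw [lintegral_biUnion_finset _ fun k _ => measurableSet_cell ρ k]
          intro k _ l _ hkl
          exact Disjoint.preimage _ (by simpa using hkl)
      _ ≤ ∫⁻ x in D', ∫⁻ y in Metric.closedBall x (d * ρ),
          ENNReal.ofReal ((g n x - g n y) ^ 2) := lintegral_mono_set (iUnion₂_subset hcell)
      _ ≤ _ := lintegral_closedBall_sq_sub_le (hg.pos n) (hg.measurable n) (hg.bound n)
          fun x hx => (hD'ball x hx).trans hn
      -- The ball of radius `d * ρ` has volume `d^d * ρ^d * V`: its factor `ρ^d` is the cell volume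
      -- `v`, and the rest tends to `0` with `ρ`.
      _ ≤ v * ENNReal.ofReal ((d : ℝ) ^ d * V * C * (d * ρ + ρ) ^ 2) := by
          rw [Measure.addHaar_closedBall _ _ hdρ,
            ← hVe, finrank_euclideanSpace_fin, mul_pow, ENNReal.ofReal_mul (by positivity),
            ENNReal.ofReal_mul (by positivity), ENNReal.ofReal_mul (by positivity),
            ENNReal.ofReal_mul (by positivity), ENNReal.ofReal_pow hρ.le, ENNReal.ofReal_coe_nnreal,
            ENNReal.ofReal_coe_nnreal, ← hv]
          have h1 : ENNReal.ofReal ((d * ρ + δ n) ^ 2) ≤ ENNReal.ofReal ((d * ρ + ρ) ^ 2) := by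
            have := (hg.pos n).le
            gcongr
          calc _ ≤ ENNReal.ofReal (d ^ d) * v * V * (C * ENNReal.ofReal ((d * ρ + ρ) ^ 2)) := by
                gcongr
            _ = _ := by ring
      _ ≤ v * ε := by
          gcongr
          exact ENNReal.ofReal_le_of_le_toReal (by simpa using hρε)
  -- A bound for the squared cell values: integrate `a k = (a k - g) + g` squared over one cell, of
  -- volume `v`.
  set X : ℝ≥0∞ := (2 * ε + 2 * B') / v with hX
  have hXt : X ≠ ∞ := ENNReal.div_ne_top (by finiteness) hv0
  refine ⟨ρ, hρ, √X.toReal, ?_⟩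
  filter_upwards [key, hB'] with n hn hnB
  have hvol : ∀ k, volume (cell (d := d) ρ k) = v := fun k => volume_cell hρ k
  choose a ha using fun k => exists_const_sqInt_le (B := cell ρ k) (by rw [hvol]; exact hv0)
    (by rw [hvol]; exact hvt) (hg.measurable n)
  simp only [hvol] at ha
  refine ⟨fun k => if k ∈ T then a k else 0, fun k => ?_, ?_⟩
  · dsimp only
    split_ifs with hk
    · have h1 : sqInt (cell ρ k) (fun x => g n x - a k) ≤ ε := by
        have := (ha k).trans ((Finset.single_le_sum (fun _ _ => zero_le) hk).trans hn)
        rwa [ENNReal.mul_le_mul_iff_right hv0 hvt] at this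
      have h2 : sqInt (cell ρ k) (fun _ => a k) ≤ 2 * ε + 2 * B' := by
        have := (hg.measurable n)
        refine (sqInt_le_add (f := fun x => a k - g n x) (g := g n) (by fun_prop)
          fun x => by ring).trans ?_
        rw [sqInt_sub_comm (f := fun _ => a k) (g := g n)]
        gcongr
        exact (sqInt_mono_set (hcell k hk)).trans hnB
      rw [sqInt_const, hvol, ← ENNReal.le_div_iff_mul_le (Or.inl hv0) (Or.inl hvt), ← hX,
        ENNReal.ofReal_le_iff_le_toReal hXt] at h2
      exact Real.abs_le_sqrt h2
    · simp
  · have h3 : v * sqInt D (fun x => g n x - if cellIndex ρ x ∈ T then a (cellIndex ρ x) else 0) ≤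
        v * ε := by
      calc _ ≤ v * ∑ k ∈ T, sqInt (cell ρ k)
            (fun x => g n x - if cellIndex ρ x ∈ T then a (cellIndex ρ x) else 0) := by
            gcongr; exact sqInt_le_sum_cell hTD _
        _ = ∑ k ∈ T, v * sqInt (cell ρ k) (fun x => g n x - a k) := by
            rw [Finset.mul_sum]
            refine Finset.sum_congr rfl fun k hk => ?_
            congr 1
            refine sqInt_congr_set (measurableSet_cell ρ k) fun x hx => ?_
            have : cellIndex ρ x = k := hx
            rw [this, if_pos hk]
        _ ≤ _ := (Finset.sum_le_sum fun k _ => ha k).trans hn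
    rwa [ENNReal.mul_le_mul_iff_right hv0 hvt] at h3

/-- Only finitely many cells meet `D`, so the cell values range over a compact box `[-B, B]^T`,
which finitely many small balls cover. The two errors of `ε / 4` are each doubled by the splitting.
-/
theorem exists_finite_net (hg : ShiftBounded Ω δ R C g) (hΩ : IsOpen Ω)
    (hb : ∀ x ∈ Ω, BoundedNear g x) {D : Set (Euc d)} (hD : IsCompact D) (hDΩ : D ⊆ Ω)
    {ε : ℝ≥0} (hε : 0 < ε) :
    ∃ S : Set (Euc d → ℝ), S.Finite ∧ (∀ s ∈ S, MemLp s 2 (volume.restrict D)) ∧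
      ∀ᶠ n in atTop, ∃ s ∈ S, sqInt D (fun x => g n x - s x) ≤ ε := by
  obtain ⟨ρ, hρ, B, h⟩ := hg.exists_cellwise_approx hΩ hb hD hDΩ (ε := ε / 4) (by positivity)
  have hfin := finite_cellIndex_image hρ hD.isBounded
  set T := hfin.toFinset with hT
  have hTD : ∀ x ∈ D, cellIndex ρ x ∈ T := fun x hx => by
    rw [hT, Set.Finite.mem_toFinset]; exact mem_image_of_mem _ hx
  obtain ⟨η, hη, hηε⟩ : ∃ η > 0, ENNReal.ofReal (η ^ 2) * volume D ≤ (ε / 4 : ℝ≥0) := by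
    have h1 : Tendsto (fun η : ℝ => ENNReal.ofReal (η ^ 2) * volume D) (𝓝[>] 0) (𝓝 0) := by
      have : Continuous fun η : ℝ => ENNReal.ofReal (η ^ 2) * volume D := by
        refine ENNReal.continuous_mul_const hD.measure_lt_top.ne |>.comp ?_
        exact ENNReal.continuous_ofReal.comp (by fun_prop)
      simpa using (this.tendsto 0).mono_left nhdsWithin_le_nhds
    obtain ⟨η, h⟩ := ((h1.eventually_le_const (u := ((ε / 4 : ℝ≥0) : ℝ≥0∞)) (by
      exact_mod_cast (by positivity : 0 < ε / 4))).and self_mem_nhdsWithin).exists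
    exact ⟨η, h.2, h.1⟩
  obtain ⟨t, -, htf, ht⟩ := (isCompact_univ_pi fun _ : T => isCompact_Icc (a := -B) (b := B)
    ).finite_cover_balls hη
  classical
  set ext : (T → ℝ) → (Fin d → ℤ) → ℝ := fun b k => if hk : k ∈ T then b ⟨k, hk⟩ else 0 with hext
  refine ⟨(fun b x => ext b (cellIndex ρ x)) '' t, htf.image _, ?_, ?_⟩
  · rintro _ ⟨b, -, rfl⟩
    exact memLp_comp_cellIndex hρ hD.isBounded (ext b)
  · filter_upwards [h] with n ⟨a, haB, ha⟩
    have hmem : (fun k : T => a k) ∈ Set.pi univ fun _ : T => Icc (-B) B :=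
      fun k _ => abs_le.1 (haB k)
    obtain ⟨b, hb, hab⟩ := mem_iUnion₂.1 (ht hmem)
    refine ⟨_, mem_image_of_mem _ hb, ?_⟩
    have hm := hg.measurable n
    have hm' := measurable_comp_cellIndex (d := d) ρ a
    refine (sqInt_le_add (f := fun x => g n x - a (cellIndex ρ x))
      (g := fun x => a (cellIndex ρ x) - ext b (cellIndex ρ x))
      (hm.sub hm').aemeasurable fun x => by ring).trans ?_
    have h2 : sqInt D (fun x => a (cellIndex ρ x) - ext b (cellIndex ρ x)) ≤ (ε / 4 : ℝ≥0) := by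
      refine (setLIntegral_mono' hD.measurableSet fun x hx => ?_).trans
        ((setLIntegral_const D (ENNReal.ofReal (η ^ 2))).trans_le hηε)
      refine ENNReal.ofReal_le_ofReal ?_
      rw [hext]
      simp only [dif_pos (hTD x hx)]
      have := (dist_pi_lt_iff hη).1 hab ⟨_, hTD x hx⟩
      rw [Real.dist_eq] at this
      rw [← sq_abs]
      gcongr
    calc _ ≤ 2 * ((ε / 4 : ℝ≥0) : ℝ≥0∞) + 2 * ((ε / 4 : ℝ≥0) : ℝ≥0∞) := by gcongr
      _ = ε := by
        norm_cast
        have : 2 * (ε / 4) + 2 * (ε / 4) = ε := by ring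
        exact_mod_cast this

end ShiftBounded

/-! ### Exhaustion by compact sets and compactness in `L²_loc`. -/

section Exhaustion

variable {d : ℕ} {Ω : Set (Euc d)}

/-- The points of `Ω` at distance at least `1 / (m + 1)` from the complement of `Ω`. -/
def innerPart (Ω : Set (Euc d)) (m : ℕ) : Set (Euc d) :=
  {x | ((m + 1 : ℕ) : ℝ≥0∞)⁻¹ ≤ Metric.infEDist x Ωᶜ}

theorem isClosed_innerPart (m : ℕ) : IsClosed (innerPart Ω m) :=
  isClosed_le continuous_const Metric.continuous_infEDist

theorem innerPart_subset (m : ℕ) : innerPart Ω m ⊆ Ω := by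
  intro x hx
  by_contra h
  have h0 : Metric.infEDist x Ωᶜ = 0 := Metric.infEDist_zero_of_mem h
  rw [innerPart, mem_ofPred_eq, h0] at hx
  simp at hx

theorem isCompact_innerPart (hΩ : Bornology.IsBounded Ω) (m : ℕ) : IsCompact (innerPart Ω m) :=
  Metric.isCompact_of_isClosed_isBounded (isClosed_innerPart m) (hΩ.subset (innerPart_subset m))

theorem innerPart_mono : Monotone (innerPart Ω) := by
  intro m n hmn x hx
  refine le_trans ?_ (mem_ofPred_eq ▸ hx)
  rw [ENNReal.inv_le_inv]
  exact_mod_cast Nat.succ_le_succ hmn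

theorem IsCompact.exists_subset_innerPart (hΩ : IsOpen Ω) {D : Set (Euc d)} (hD : IsCompact D)
    (hDΩ : D ⊆ Ω) : ∃ m, D ⊆ innerPart Ω m := by
  obtain ⟨η, hη, h⟩ := hD.exists_thickening_subset_open hΩ hDΩ
  obtain ⟨m, hm⟩ := ENNReal.exists_inv_nat_lt (ENNReal.ofReal_pos.2 hη).ne'
  refine ⟨m, fun x hx => ?_⟩
  refine le_trans ?_ (Metric.le_infEDist.2 fun y hy => ?_ : ENNReal.ofReal η ≤ _)
  · refine le_trans ?_ hm.le
    rw [ENNReal.inv_le_inv]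
    exact_mod_cast Nat.le_succ m
  · by_contra! hlt
    refine hy (h (Metric.mem_thickening_iff.2 ⟨x, hx, ?_⟩))
    rwa [edist_comm, edist_lt_ofReal] at hlt

theorem iUnion_innerPart (hΩ : IsOpen Ω) : ⋃ m, innerPart Ω m = Ω := by
  refine subset_antisymm (iUnion_subset innerPart_subset) fun x hx => ?_
  obtain ⟨m, hm⟩ := isCompact_singleton.exists_subset_innerPart hΩ (singleton_subset_iff.2 hx)
  exact mem_iUnion.2 ⟨m, hm rfl⟩

end Exhaustion

/-- Functions on an increasing sequence of measurable sets that agree almost everywhere on the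
smaller sets come from one function. -/
theorem exists_ae_eq_of_ae_eq {α β : Type*} [MeasurableSpace α] [Inhabited β] {μ : Measure α}
    {D : ℕ → Set α} (hD : ∀ m, MeasurableSet (D m)) {a : ℕ → α → β}
    (h : ∀ l m, l ≤ m → a l =ᵐ[μ.restrict (D l)] a m) :
    ∃ w : α → β, ∀ m, w =ᵐ[μ.restrict (D m)] a m := by
  classical
  refine ⟨fun x => if hx : ∃ m, x ∈ D m then a (Nat.find hx) x else default, fun m => ?_⟩
  have hall : ∀ᵐ x ∂μ, ∀ l, l ≤ m → x ∈ D l → a l x = a m x := by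
    refine ae_all_iff.2 fun l => ?_
    by_cases hl : l ≤ m
    · filter_upwards [(ae_restrict_iff' (hD l)).1 (h l m hl)] with x hx _ using hx
    · exact ae_of_all _ fun x hx => absurd hx hl
  refine (ae_restrict_iff' (hD m)).2 ?_
  filter_upwards [hall] with x hx hxm
  have hex : ∃ m, x ∈ D m := ⟨m, hxm⟩
  rw [dif_pos hex]
  exact hx _ (Nat.find_min' hex hxm) (Nat.find_spec hex)

namespace ShiftBounded

variable {d : ℕ} {Ω : Set (Euc d)} {δ : ℕ → ℝ} {R : ℝ} {C : ℝ≥0} {g : ℕ → Euc d → ℝ}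

/-- The finite net only serves the tail of the sequence; the finitely many earlier terms are added
as their own centres. -/
theorem totallyBounded_range_toLp (hg : ShiftBounded Ω δ R C g) (hΩ : IsOpen Ω)
    (hb : ∀ x ∈ Ω, BoundedNear g x) {D : Set (Euc d)} (hD : IsCompact D) (hDΩ : D ⊆ Ω)
    (hmem : ∀ n, MemLp (g n) 2 (volume.restrict D)) :
    TotallyBounded (range fun n => (hmem n).toLp (g n)) := by
  rw [EMetric.totallyBounded_iff]
  intro ε hε
  obtain ⟨ε', hε', hεε'⟩ := ENNReal.lt_iff_exists_nnreal_btwn.1 (pos_iff_ne_zero.2 (pow_ne_zero 2 hε.ne'))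
  obtain ⟨S, hSf, hSm, hS⟩ := hg.exists_finite_net hΩ hb hD hDΩ (ENNReal.coe_pos.1 hε')
  obtain ⟨N, hN⟩ := eventually_atTop.1 hS
  have : Finite S := hSf
  refine ⟨range (fun s : S => (hSm s s.2).toLp s) ∪ (fun n => (hmem n).toLp (g n)) '' Iio N,
    (finite_range _).union ((finite_Iio N).image _), ?_⟩
  rintro _ ⟨n, rfl⟩
  rcases lt_or_ge n N with hn | hn
  · exact mem_biUnion (Or.inr (mem_image_of_mem _ hn)) (by simpa using hε)
  · obtain ⟨s, hs, hle⟩ := hN n hn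
    refine mem_biUnion (Or.inl ⟨⟨s, hs⟩, rfl⟩) ?_
    change edist _ _ < ε
    rw [Lp.edist_toLp_toLp]
    refine lt_of_pow_lt_pow_left' 2 (lt_of_le_of_lt ?_ hεε')
    rw [sqInt_eq_eLpNorm_sq] at hle
    exact hle

/-- Compactness in `L²_loc(Ω)`, up to additive constants. -/
theorem exists_tendstoL2Loc (hg : ShiftBounded Ω δ R C g) (hΩ : IsOpen Ω) (hc : IsConnected Ω)
    (hbd : Bornology.IsBounded Ω)
    (hmem : ∀ n D, IsCompact D → MemLp (g n) 2 (volume.restrict D)) :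
    ∃ (φ : ℕ → ℕ) (c : ℕ → ℝ) (w : Euc d → ℝ), StrictMono φ ∧
      TendstoL2Loc Ω (fun j x => g (φ j) x + c j) w := by
  obtain ⟨c, hb⟩ := hg.exists_boundedNear hΩ hc
  have hh := hg.add_const c
  have hmemh : ∀ n m, MemLp (fun x => g n x + c n) 2 (volume.restrict (innerPart Ω m)) := by
    intro n m
    have hm := isCompact_innerPart hbd m
    have : IsFiniteMeasure (volume.restrict (innerPart Ω m)) := ⟨by simpa using hm.measure_lt_top⟩
    exact (hmem n _ hm).add (memLp_const _)
  have htb := fun m => hh.totallyBounded_range_toLp hΩ hb (isCompact_innerPart hbd m)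
    (innerPart_subset m) (fun n => hmemh n m)
  -- Compactness of the countable product yields one subsequence converging on every `innerPart Ω
  -- m`, in place of a diagonal extraction.
  have hcomp : IsCompact (Set.pi univ fun m => closure (range fun n => (hmemh n m).toLp _)) :=
    isCompact_univ_pi fun m =>
      (TotallyBounded.closure (htb m)).isCompact_of_isClosed isClosed_closure
  obtain ⟨a, -, φ, hφ, hlim⟩ := hcomp.tendsto_subseq (x := fun n m => (hmemh n m).toLp _)
    fun n m _ => subset_closure ⟨n, rfl⟩
  have hlim' : ∀ m, Tendsto (fun j => eLpNorm (fun x => g (φ j) x + c (φ j) - a m x) 2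
      (volume.restrict (innerPart Ω m))) atTop (𝓝 0) := by
    intro m
    have h1 := (tendsto_pi_nhds.1 hlim m)
    rw [tendsto_iff_edist_tendsto_0] at h1
    refine h1.congr fun j => ?_
    rw [Lp.edist_def]
    refine eLpNorm_congr_ae ?_
    filter_upwards [(hmemh (φ j) m).coeFn_toLp] with x hx
    simp [hx]
  -- Both are limits of the same subsequence on the smaller set.
  have hglue : ∀ l m, l ≤ m → a l =ᵐ[volume.restrict (innerPart Ω l)] a m := by
    intro l m hlm
    have hsub := innerPart_mono (Ω := Ω) hlm
    have hm : AEStronglyMeasurable (a m) (volume.restrict (innerPart Ω l)) :=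
      (Lp.aestronglyMeasurable (a m)).mono_measure (Measure.restrict_mono hsub le_rfl)
    have hz : eLpNorm (fun x => a l x - a m x) 2 (volume.restrict (innerPart Ω l)) = 0 := by
      refine le_antisymm (ge_of_tendsto' (f := fun j =>
        eLpNorm (fun x => g (φ j) x + c (φ j) - a l x) 2 (volume.restrict (innerPart Ω l)) +
        eLpNorm (fun x => g (φ j) x + c (φ j) - a m x) 2 (volume.restrict (innerPart Ω m)))
        (by simpa using (hlim' l).add (hlim' m)) fun j => ?_) zero_le
      have hj := (hh.measurable (φ j)).aestronglyMeasurable (μ := volume.restrict (innerPart Ω l))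
      calc eLpNorm (fun x => a l x - a m x) 2 (volume.restrict (innerPart Ω l))
          = eLpNorm ((fun x => g (φ j) x + c (φ j) - a m x) -
              fun x => g (φ j) x + c (φ j) - a l x) 2 (volume.restrict (innerPart Ω l)) := by
            congr 1; ext x; simp
        _ ≤ _ := eLpNorm_sub_le (hj.sub hm) (hj.sub (Lp.aestronglyMeasurable _)) (by norm_num)
        _ ≤ _ := by
            rw [add_comm]
            gcongr
    have hz' := (eLpNorm_eq_zero_iff ((Lp.aestronglyMeasurable (a l)).sub hm) (by simp)).1 hz
    filter_upwards [hz'] with x hx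
    simpa [sub_eq_zero] using hx
  obtain ⟨w, hw⟩ := exists_ae_eq_of_ae_eq (fun m => (isClosed_innerPart m).measurableSet) hglue
  refine ⟨φ, fun j => c (φ j), w, hφ, fun D hD hDΩ => ?_⟩
  obtain ⟨m, hm⟩ := hD.exists_subset_innerPart hΩ hDΩ
  have hle : volume.restrict D ≤ volume.restrict (innerPart Ω m) :=
    Measure.restrict_mono hm le_rfl
  refine ⟨((memLp_congr_ae (hw m)).2 (Lp.memLp (a m))).mono_measure hle, ?_⟩
  refine tendsto_of_tendsto_of_tendsto_of_le_of_le tendsto_const_nhds (hlim' m)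
    (fun _ => zero_le) fun j => ?_
  refine (eLpNorm_mono_measure _ hle).trans_eq (eLpNorm_congr_ae ?_)
  filter_upwards [hw m] with x hx
  rw [hx]

end ShiftBounded

/-! ### Limits: Lipschitz dependence on shifts and membership in `H¹`. -/

/-- The `L²` norm of the increment `w (· + z) - w` is at most of order `‖z‖`, on compact sets whose
translates along the segment from `0` to `z` stay in `Ω`. -/
def ShiftLipschitz {d : ℕ} (Ω : Set (Euc d)) (C : ℝ≥0) (w : Euc d → ℝ) : Prop :=
  ∀ (A : Set (Euc d)) (z : Euc d), IsCompact A →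
    (∀ x ∈ A, ∀ t ∈ Icc (0 : ℝ) 1, x + t • z ∈ Ω) →
      sqInt A (fun x => w (x + z) - w x) ≤ C * ENNReal.ofReal (‖z‖ ^ 2)

/-- Pass to the limit in the telescoped estimate: `‖z‖ + δ n` becomes `‖z‖`. The factor `4` comes
from splitting the square twice to compare `w` with `g n` at both ends of the shift. -/
theorem ShiftBounded.shiftLipschitz {d : ℕ} {Ω : Set (Euc d)} {δ : ℕ → ℝ} {R : ℝ} {C : ℝ≥0}
    {g : ℕ → Euc d → ℝ} (hg : ShiftBounded Ω δ R C g) (hΩ : IsOpen Ω) {w : Euc d → ℝ}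
    (hw : TendstoL2Loc Ω g w) : ShiftLipschitz Ω (4 * C) w := by
  intro A z hA hAz
  have hAΩ : A ⊆ Ω := fun x hx => by simpa using hAz x hx 0 (by simp)
  have hA1 : (fun x => x + z) '' A ⊆ Ω := by
    rintro _ ⟨x, hx, rfl⟩
    simpa using hAz x hx 1 (by simp)
  have hAc : IsCompact ((fun x => x + z) '' A) := hA.image (by fun_prop)
  set D : Set (Euc d) := (fun p : Euc d × ℝ => p.1 + p.2 • z) '' (A ×ˢ Icc (0 : ℝ) 1)
  have hD : IsCompact D := (hA.prod isCompact_Icc).image (by fun_prop)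
  have hDΩ : D ⊆ Ω := by
    rintro _ ⟨⟨x, t⟩, ⟨hx, ht⟩, rfl⟩
    exact hAz x hx t ht
  obtain ⟨hwA, hlimA⟩ := hw A hA hAΩ
  obtain ⟨-, hlim1⟩ := hw _ hAc hA1
  rw [tendsto_eLpNorm_two_iff] at hlimA hlim1
  have hlim : Tendsto (fun n => 2 * sqInt A (fun x => g n x - w x) +
      2 * (2 * (C * ENNReal.ofReal ((‖z‖ + δ n) ^ 2)) +
        2 * sqInt ((fun x => x + z) '' A) (fun x => g n x - w x))) atTop
      (𝓝 (2 * 0 + 2 * (2 * (C * ENNReal.ofReal ((‖z‖ + 0) ^ 2)) + 2 * 0))) := by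
    have h1 : Tendsto (fun n => ENNReal.ofReal ((‖z‖ + δ n) ^ 2)) atTop
        (𝓝 (ENNReal.ofReal ((‖z‖ + 0) ^ 2))) :=
      ENNReal.tendsto_ofReal ((hg.tendsto.const_add _).pow 2)
    refine (ENNReal.Tendsto.const_mul hlimA (by simp)).add (ENNReal.Tendsto.const_mul
      ((ENNReal.Tendsto.const_mul (ENNReal.Tendsto.const_mul h1 (by simp)) (by simp)).add
        (ENNReal.Tendsto.const_mul hlim1 (by simp))) (by simp))
  refine (ge_of_tendsto hlim ?_).trans_eq ?_
  · filter_upwards [hg.eventually_subset hΩ hD hDΩ] with n hn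
    have hm := hg.measurable n
    have hT := sqInt_shift_le (A := A) (z := z) (hg.pos n) hm (hg.bound n)
      fun x hx t ht => hn ⟨(x, t), ⟨hx, ht⟩, rfl⟩
    have h1 : AEMeasurable (fun x => g n x - w x) (volume.restrict A) :=
      hm.aemeasurable.sub hwA.1.aemeasurable
    refine (sqInt_le_add h1 (g := fun x => (g n (x + z) - g n x) + (w (x + z) - g n (x + z)))
      fun x => by ring).trans ?_
    gcongr
    refine (sqInt_le_add (f := fun x => g n (x + z) - g n x)
      (g := fun x => w (x + z) - g n (x + z)) (by fun_prop) fun x => rfl).trans ?_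
    gcongr
    rw [sqInt_comp_add_right (fun x => w x - g n x), sqInt_sub_comm]
  · simp only [add_zero, mul_zero, zero_add]
    push_cast
    ring

namespace ShiftLipschitz

variable {d : ℕ} {Ω : Set (Euc d)} {C : ℝ≥0} {w : Euc d → ℝ}

/-- Monotone convergence along the compact exhaustion of `U`; the constant does not depend on the
compact set. -/
theorem sqInt_le_of_isOpen (hT : ShiftLipschitz Ω C w) {U : Set (Euc d)} (hU : IsOpen U)
    (hUb : Bornology.IsBounded U) {z : Euc d}
    (hz : ∀ x ∈ U, ∀ t ∈ Icc (0 : ℝ) 1, x + t • z ∈ Ω) :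
    sqInt U (fun x => w (x + z) - w x) ≤ C * ENNReal.ofReal (‖z‖ ^ 2) := by
  rw [sqInt, ← iUnion_innerPart hU, setLIntegral_iUnion_of_directed _
    (innerPart_mono (Ω := U)).directed_le]
  exact iSup_le fun m => hT _ z (isCompact_innerPart hUb m) fun x hx =>
    hz x (innerPart_subset m hx)

/-- Near a boundary point, translation by a fixed `z` in the vertical direction moves `Ω` into a
compact subset of `Ω`, where `w` is square integrable; the increment `w (· + z) - w` is controlled
up to the boundary, hence so is `w`. -/
theorem exists_sqInt_ball_lt_top (hT : ShiftLipschitz Ω C w) (hΩ : IsOpen Ω)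
    (hLip : HasLipschitzBoundary Ω)
    (hw : ∀ D, IsCompact D → D ⊆ Ω → MemLp w 2 (volume.restrict D)) {x : Euc d}
    (hx : x ∈ closure Ω) : ∃ ρ > 0, sqInt (Ω ∩ Metric.ball x ρ) w < ∞ := by
  by_cases hxΩ : x ∈ Ω
  · obtain ⟨ρ, hρ, h⟩ := Metric.nhds_basis_closedBall.mem_iff.1 (hΩ.mem_nhds hxΩ)
    refine ⟨ρ, hρ, (sqInt_mono_set (inter_subset_right.trans Metric.ball_subset_closedBall)
      ).trans_lt ?_⟩
    have := hw _ (isCompact_closedBall x ρ) h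
    exact (memLp_two_iff_sqInt this.1).1 this
  obtain ⟨ν, γ, L, r, hν, hγ, hr, hiff⟩ := hLip x (by
    rw [hΩ.frontier_eq]; exact ⟨hx, hxΩ⟩)
  have hproj : ∀ y : Euc d, ∀ t : ℝ, (ℝ ∙ ν)ᗮ.orthogonalProjectionOnto (y + t • ν) =
      (ℝ ∙ ν)ᗮ.orthogonalProjectionOnto y := by
    intro y t
    rw [map_add, add_eq_left]
    refine Submodule.orthogonalProjectionOnto_eq_zero_iff.2 ?_
    rw [Submodule.orthogonal_orthogonal]
    exact Submodule.smul_mem _ _ (Submodule.mem_span_singleton_self ν)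
  have hinner : ∀ y : Euc d, ∀ t : ℝ, ⟪ν, y + t • ν⟫ = ⟪ν, y⟫ + t := by
    intro y t
    rw [inner_add_right, real_inner_smul_right, real_inner_self_eq_norm_sq, hν]
    ring
  have hball : ∀ y ∈ Metric.closedBall x (r / 4), ∀ t ∈ Icc (0 : ℝ) (r / 4),
      y + t • ν ∈ Metric.ball x r := by
    intro y hy t ht
    have h1 : dist (y + t • ν) y ≤ r / 4 := by
      simp only [dist_self_add_left, norm_smul, hν, mul_one, Real.norm_eq_abs, abs_of_nonneg ht.1]
      exact ht.2
    rw [Metric.mem_ball]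
    rw [Metric.mem_closedBall] at hy
    linarith [dist_triangle (y + t • ν) y x]
  set z : Euc d := (r / 4) • ν with hz
  set D : Set (Euc d) := (fun y => y + z) '' (closure Ω ∩ Metric.closedBall x (r / 4)) with hDdef
  have hD : IsCompact D := ((isCompact_closedBall x (r / 4)).inter_left isClosed_closure).image
    (by fun_prop)
  have hDΩ : D ⊆ Ω := by
    rintro _ ⟨y, ⟨hyΩ, hy⟩, rfl⟩
    have hyr : y ∈ Metric.ball x r := by
      simpa using hball y hy 0 ⟨le_rfl, by positivity⟩
    refine (hiff _ (hball y hy (r / 4) ⟨by positivity, le_rfl⟩)).2 ?_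
    rw [hproj, hinner]
    -- On the closure of `Ω` the epigraph inequality survives only in non-strict form; raising the
    -- point by `r / 4` makes it strict again.
    have hle : γ ((ℝ ∙ ν)ᗮ.orthogonalProjectionOnto y) ≤ ⟪ν, y⟫ := by
      have hcl : y ∈ closure (Ω ∩ Metric.ball x r) :=
        Metric.isOpen_ball.closure_inter ⟨hyΩ, hyr⟩
      refine closure_minimal (t := {y | γ ((ℝ ∙ ν)ᗮ.orthogonalProjectionOnto y) ≤ ⟪ν, y⟫})
        (fun y' hy' => ((hiff y' hy'.2).1 hy'.1).le) (isClosed_le ?_ ?_) hcl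
      · exact hγ.continuous.comp (ContinuousLinearMap.continuous _)
      · fun_prop
    linarith
  have hmemD := hw D hD hDΩ
  have hsqD : sqInt D w < ∞ := (memLp_two_iff_sqInt hmemD.1).1 hmemD
  refine ⟨r / 4, by positivity, ?_⟩
  set U := Ω ∩ Metric.ball x (r / 4) with hU
  have hUD : (fun y => y + z) '' U ⊆ D :=
    image_mono (inter_subset_inter subset_closure Metric.ball_subset_closedBall)
  have hUo : IsOpen U := hΩ.inter Metric.isOpen_ball
  have hshift : sqInt U (fun y => w (y + z) - w y) ≤ C * ENNReal.ofReal (‖z‖ ^ 2) := by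
    refine hT.sqInt_le_of_isOpen hUo (Metric.isBounded_ball.subset inter_subset_right) ?_
    rintro y ⟨hyΩ, hy⟩ t ht
    have hy' := Metric.ball_subset_closedBall hy
    have hyr : y ∈ Metric.ball x r := by
      simpa using hball y hy' 0 ⟨le_rfl, by positivity⟩
    have ht' : t * (r / 4) ∈ Icc 0 (r / 4) :=
      ⟨mul_nonneg ht.1 (by positivity), mul_le_of_le_one_left (by positivity) ht.2⟩
    rw [hz, smul_smul]
    refine (hiff _ (hball y hy' _ ht')).2 ?_
    rw [hproj, hinner]
    have := (hiff y hyr).1 hyΩ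
    linarith [ht'.1]
  have hmeas : AEMeasurable (fun y => w (y + z)) (volume.restrict U) := by
    have h1 : AEMeasurable w (volume.restrict ((fun y => y + z) '' U)) :=
      (hmemD.1.aemeasurable).mono_measure (Measure.restrict_mono hUD le_rfl)
    have h2 : MeasurePreserving (fun y => y + z) (volume.restrict U)
        (volume.restrict ((fun y => y + z) '' U)) :=
      (measurePreserving_add_right volume z).restrict_image_emb (measurableEmbedding_addRight z) U
    exact h1.comp_quasiMeasurePreserving h2.quasiMeasurePreserving
  refine (sqInt_le_add (f := fun y => w (y + z)) (g := fun y => w y - w (y + z)) hmeas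
    fun y => by ring).trans_lt ?_
  rw [sqInt_comp_add_right, sqInt_sub_comm (f := w)]
  have h1 := ((sqInt_mono_set (f := w) hUD).trans_lt hsqD).ne
  have h2 := (hshift.trans_lt (by finiteness)).ne
  finiteness

/-- On a bounded Lipschitz set, a locally square integrable function with square integrable
increments is square integrable. -/
theorem memLp (hT : ShiftLipschitz Ω C w) (hΩ : IsOpen Ω) (hbd : Bornology.IsBounded Ω)
    (hLip : HasLipschitzBoundary Ω)
    (hw : ∀ D, IsCompact D → D ⊆ Ω → MemLp w 2 (volume.restrict D)) :
    MemLp w 2 (volume.restrict Ω) := by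
  have hm : AEStronglyMeasurable w (volume.restrict Ω) := by
    rw [← iUnion_innerPart hΩ]
    exact AEStronglyMeasurable.iUnion fun m =>
      (hw _ (isCompact_innerPart hbd m) (innerPart_subset m)).1
  rw [memLp_two_iff_sqInt hm]
  have hcl : IsCompact (closure Ω) := hbd.isCompact_closure
  have := hcl.induction_on (p := fun s => sqInt (Ω ∩ s) w < ∞) (by simp [sqInt])
    (fun s t hst ht => (sqInt_mono_set (inter_subset_inter_right _ hst)).trans_lt ht)
    (fun s t hs ht => ?_) (fun x hx => ?_)
  · rwa [inter_eq_left.2 subset_closure] at this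
  · rw [inter_union_distrib_left]
    exact (lintegral_union_le _ _ _).trans_lt (ENNReal.add_lt_top.2 ⟨hs, ht⟩)
  · obtain ⟨ρ, hρ, h⟩ := hT.exists_sqInt_ball_lt_top hΩ hLip hw hx
    exact ⟨_, mem_nhdsWithin_of_mem_nhds (Metric.ball_mem_nhds x hρ), h⟩

end ShiftLipschitz

/-- A linear functional that is bounded by the norm of the image in a Hilbert space is represented
by an element of that space. -/
theorem exists_inner_eq_of_abs_le {V H : Type*} [AddCommGroup V] [Module ℝ V]
    [NormedAddCommGroup H] [InnerProductSpace ℝ H] [CompleteSpace H] (ι : V →ₗ[ℝ] H)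
    (l : V →ₗ[ℝ] ℝ) (M : ℝ) (h : ∀ v, |l v| ≤ M * ‖ι v‖) :
    ∃ G : H, ∀ v, l v = ⟪G, ι v⟫ := by
  -- `ι` need not be injective, so a linear section over its range is used to transport `l`.
  obtain ⟨s, hs⟩ := ι.rangeRestrict.exists_rightInverse_of_surjective ι.range_rangeRestrict
  have hsι : ∀ y, ι (s y) = y := fun y => congrArg Subtype.val (LinearMap.congr_fun hs y)
  set f : StrongDual ℝ (LinearMap.range ι) := (l ∘ₗ s).mkContinuous M fun y => by
    simpa [hsι] using h (s y)
  obtain ⟨F, hF, -⟩ := exists_extension_norm_eq _ f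
  refine ⟨(InnerProductSpace.toDual ℝ H).symm F, fun v => ?_⟩
  rw [InnerProductSpace.toDual_symm_apply]
  have h1 : F (ι v) = l (s (ι.rangeRestrict v)) := hF (ι.rangeRestrict v)
  -- `s (ι v)` and `v` have the same image under `ι`, so the assumed bound forces `l` to agree on
  -- them.
  rw [h1, ← sub_eq_zero, ← map_sub, ← abs_nonpos_iff]
  refine (h _).trans_eq ?_
  rw [map_sub, hsι]
  simp

/-- The test functions on `Ω`. -/
def testFunctions {d : ℕ} (Ω : Set (Euc d)) : Submodule ℝ (Euc d → ℝ) where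
  carrier := {ψ | ContDiff ℝ (⊤ : ℕ∞) ψ ∧ HasCompactSupport ψ ∧ tsupport ψ ⊆ Ω}
  add_mem' := fun {_ _} h h' => ⟨h.1.add h'.1, h.2.1.add h'.2.1,
    (tsupport_add _ _).trans (union_subset h.2.2 h'.2.2)⟩
  zero_mem' := ⟨contDiff_const, HasCompactSupport.zero, by simp [tsupport]⟩
  smul_mem' := fun c _ h => ⟨contDiff_const.smul h.1, h.2.1.smul_left,
    (tsupport_smul_subset_right (fun _ => c) _).trans h.2.2⟩

namespace ShiftLipschitz

variable {d : ℕ} {Ω : Set (Euc d)} {C : ℝ≥0} {w ψ : Euc d → ℝ}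

/-- Discrete integration by parts: translation invariance moves the shift from `ψ` to `w`, and
Cauchy–Schwarz on the support of `ψ` uses the increment bound for `-z`. Extending `w` by zero puts
the integrals on the whole space. -/
theorem abs_integral_sub_le (hT : ShiftLipschitz Ω C w)
    (hwm : Integrable (Ω.indicator w)) (hψ : Continuous ψ) (hψc : HasCompactSupport ψ)
    (hψΩ : tsupport ψ ⊆ Ω) {z : Euc d}
    (hz : ∀ x ∈ tsupport ψ, ∀ t ∈ Icc (0 : ℝ) 1, x + t • -z ∈ Ω) :
    |∫ x, Ω.indicator w x * (ψ (x + z) - ψ x)| ≤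
      √C * ‖z‖ * (eLpNorm ψ 2 (volume.restrict Ω)).toReal := by
  set W := Ω.indicator w
  set S := tsupport ψ
  have hS : IsCompact S := hψc
  obtain ⟨B, hB⟩ := hψc.exists_bound_of_continuous hψ
  have hint : ∀ z', Integrable fun x => W x * ψ (x + z') := fun z' =>
    hwm.mul_bdd (c := B) (by fun_prop) (ae_of_all _ fun x => hB _)
  have hint' : Integrable fun x => W (x - z) * ψ x := by
    simpa using (hint z).comp_sub_right z
  have h1 : ∫ x, W x * (ψ (x + z) - ψ x) = ∫ x in S, (W (x - z) - W x) * ψ x := by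
    rw [setIntegral_eq_integral_of_forall_compl_eq_zero fun x hx => by
      rw [image_eq_zero_of_notMem_tsupport hx, mul_zero]]
    have h2 : ∫ x, W x * ψ (x + z) = ∫ x, W (x - z) * ψ x := by
      rw [← integral_add_right_eq_self (fun x => W (x - z) * ψ x) z]
      simp
    simp_rw [mul_sub, sub_mul]
    have := hint 0
    simp only [add_zero] at this
    rw [integral_sub (hint z) this, integral_sub hint' this, h2]
  have hsq : sqInt S (fun x => W (x - z) - W x) ≤ C * ENNReal.ofReal (‖z‖ ^ 2) := by
    have h3 : sqInt S (fun x => W (x - z) - W x) = sqInt S (fun x => w (x + -z) - w x) := by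
      refine sqInt_congr_set hS.measurableSet fun x hx => ?_
      have hx1 : x - z ∈ Ω := by simpa [sub_eq_add_neg] using hz x hx 1 (by simp)
      simp [W, hψΩ hx, sub_eq_add_neg]
      simp [← sub_eq_add_neg, hx1]
    rw [h3]
    simpa using hT S (-z) hS hz
  have hnorm : eLpNorm (fun x => W (x - z) - W x) 2 (volume.restrict S) ≤
      ENNReal.ofReal (√C * ‖z‖) := by
    rw [eLpNorm_two_eq]
    refine (ENNReal.rpow_le_rpow hsq (by norm_num)).trans_eq ?_
    rw [← ENNReal.ofReal_coe_nnreal, ← ENNReal.ofReal_mul (by positivity),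
      ENNReal.ofReal_rpow_of_nonneg (by positivity) (by norm_num), ← Real.sqrt_eq_rpow,
      Real.sqrt_mul (by positivity), Real.sqrt_sq (norm_nonneg z)]
  have hψL : MemLp ψ 2 (volume.restrict Ω) := (hψ.memLp_of_hasCompactSupport hψc).restrict _
  have hmain : ‖∫ x in S, (W (x - z) - W x) * ψ x‖ₑ ≤
      ENNReal.ofReal (√C * ‖z‖) * eLpNorm ψ 2 (volume.restrict Ω) := by
    refine (enorm_integral_le_lintegral_enorm _).trans ?_
    rw [← eLpNorm_one_eq_lintegral_enorm]
    have h4 := eLpNorm_smul_le_mul_eLpNorm (p := 2) (q := 2) (r := 1)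
      (hψ.aestronglyMeasurable (μ := volume.restrict S))
      (φ := fun x => W (x - z) - W x) (((hwm.comp_sub_right z).sub hwm).1.restrict)
    refine h4.trans ?_
    gcongr
  rw [h1, ← Real.norm_eq_abs, ← toReal_enorm]
  refine (ENNReal.toReal_mono (by have := hψL.2.ne; finiteness) hmain).trans_eq ?_
  rw [ENNReal.toReal_mul, ENNReal.toReal_ofReal (by positivity)]

/-- Apply `abs_integral_sub_le` with `z = h • e`, divide by `h` and let `h → 0`; the Lipschitz
constant of `ψ` gives the dominating function. -/
theorem abs_integral_fderiv_le (hT : ShiftLipschitz Ω C w) (hΩ : IsOpen Ω)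
    (hwm : Integrable (Ω.indicator w)) (hψ : ψ ∈ testFunctions Ω) (e : Euc d) :
    |∫ x, Ω.indicator w x * fderiv ℝ ψ x e| ≤
      √C * ‖e‖ * (eLpNorm ψ 2 (volume.restrict Ω)).toReal := by
  obtain ⟨hψd, hψc, hψΩ⟩ := hψ
  obtain ⟨η, hη, hηΩ⟩ := IsCompact.exists_thickening_subset_open hψc hΩ hψΩ
  obtain ⟨L, hL⟩ := hψd.lipschitzWith_of_hasCompactSupport hψc (by simp)
  have hlim : Tendsto (fun h : ℝ => ∫ x, Ω.indicator w x * (h⁻¹ * (ψ (x + h • e) - ψ x)))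
      (𝓝[≠] 0) (𝓝 (∫ x, Ω.indicator w x * fderiv ℝ ψ x e)) := by
    refine tendsto_integral_filter_of_dominated_convergence
      (fun x => ‖Ω.indicator w x‖ * (L * ‖e‖)) ?_ ?_ (hwm.norm.mul_const _) ?_
    · refine Eventually.of_forall fun h => hwm.1.mul ?_
      have := hψd.continuous
      exact Continuous.aestronglyMeasurable (by fun_prop)
    · filter_upwards [self_mem_nhdsWithin] with h hh
      refine ae_of_all _ fun x => ?_
      rw [norm_mul]
      gcongr
      have h1 := hL.dist_le_mul (x + h • e) x
      rw [dist_self_add_left, norm_smul, dist_eq_norm] at h1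
      rw [norm_mul, norm_inv, inv_mul_le_iff₀ (norm_pos_iff.2 hh)]
      linarith
    · refine ae_of_all _ fun x => Tendsto.const_mul _ ?_
      have h1 := (hψd.differentiable (by simp) x).hasFDerivAt.hasLineDerivAt e
      simpa using h1.tendsto_slope_zero
  refine le_of_tendsto hlim.abs ?_
  have h0 : ∀ᶠ h : ℝ in 𝓝[≠] 0, ‖h • e‖ < η := by
    have : Continuous fun h : ℝ => ‖h • e‖ := by fun_prop
    refine nhdsWithin_le_nhds ((this.tendsto 0).eventually_lt_const ?_)
    simpa using hη
  filter_upwards [h0, self_mem_nhdsWithin] with h hh hne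
  have h2 := hT.abs_integral_sub_le hwm hψd.continuous hψc hψΩ (z := h • e) ?_
  · have h3 : ∫ x, Ω.indicator w x * (h⁻¹ * (ψ (x + h • e) - ψ x)) =
        h⁻¹ * ∫ x, Ω.indicator w x * (ψ (x + h • e) - ψ x) := by
      rw [← integral_const_mul]
      congr 1; ext x; ring
    rw [h3, abs_mul, abs_inv, inv_mul_le_iff₀ (abs_pos.2 hne)]
    refine h2.trans_eq ?_
    rw [norm_smul, Real.norm_eq_abs]
    ring
  · intro x hx t ht
    refine hηΩ (Metric.mem_thickening_iff.2 ⟨x, hx, ?_⟩)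
    rw [dist_self_add_left, norm_smul, norm_neg, Real.norm_eq_abs, abs_of_nonneg ht.1]
    exact (mul_le_of_le_one_left (norm_nonneg _) ht.2).trans_lt hh

/-- On a bounded Lipschitz set, a locally square integrable function with square integrable
increments is in `H¹`. -/
theorem memH1 (hT : ShiftLipschitz Ω C w) (hΩ : IsOpen Ω) (hbd : Bornology.IsBounded Ω)
    (hLip : HasLipschitzBoundary Ω)
    (hw : ∀ D, IsCompact D → D ⊆ Ω → MemLp w 2 (volume.restrict D)) : MemH1 Ω w := by
  have hwL := hT.memLp hΩ hbd hLip hw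
  have : IsFiniteMeasure (volume.restrict Ω) := ⟨by simpa using hbd.measure_lt_top⟩
  have hwI : IntegrableOn w Ω := hwL.integrable (by norm_num)
  have hwm : Integrable (Ω.indicator w) := hwI.integrable_indicator hΩ.measurableSet
  have hind : ∀ f : Euc d → ℝ, ∫ x, Ω.indicator w x * f x = ∫ x in Ω, w x * f x := by
    intro f
    rw [← integral_indicator hΩ.measurableSet]
    congr 1; ext x
    by_cases hx : x ∈ Ω <;> simp [hx]
  have hmem : ∀ ψ : testFunctions Ω, MemLp ψ.1 2 (volume.restrict Ω) := fun ψ =>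
    (ψ.2.1.continuous.memLp_of_hasCompactSupport ψ.2.2.1).restrict _
  have hint : ∀ (ψ : testFunctions Ω) (e : Euc d),
      Integrable (fun x => w x * fderiv ℝ ψ.1 x e) (volume.restrict Ω) := by
    intro ψ e
    have hc : Continuous fun x => fderiv ℝ ψ.1 x e :=
      (ψ.2.1.continuous_fderiv (by simp)).clm_apply continuous_const
    obtain ⟨B, hB⟩ := (ψ.2.2.1.fderiv_apply ℝ e).exists_bound_of_continuous hc
    exact hwI.mul_bdd (c := B) hc.aestronglyMeasurable (ae_of_all _ hB)
  let ι : testFunctions Ω →ₗ[ℝ] Lp ℝ 2 (volume.restrict Ω) :=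
    { toFun := fun ψ => (hmem ψ).toLp ψ.1
      map_add' := fun ψ ψ' => rfl
      map_smul' := fun c ψ => rfl }
  let l : Fin d → testFunctions Ω →ₗ[ℝ] ℝ := fun i =>
    { toFun := fun ψ => ∫ x in Ω, w x * fderiv ℝ ψ.1 x (EuclideanSpace.single i 1)
      map_add' := fun ψ ψ' => by
        rw [← integral_add (hint ψ _) (hint ψ' _)]
        congr 1; ext x
        rw [Submodule.coe_add, fderiv_add (ψ.2.1.differentiable (by simp) x)
          (ψ'.2.1.differentiable (by simp) x)]
        simp [mul_add]
      map_smul' := fun c ψ => by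
        rw [RingHom.id_apply, smul_eq_mul, ← integral_const_mul]
        congr 1; ext x
        rw [Submodule.coe_smul, fderiv_const_smul (ψ.2.1.differentiable (by simp) x)]
        simp only [FunLike.coe_smul, Pi.smul_apply, smul_eq_mul]
        ring }
  have hl : ∀ i ψ, |l i ψ| ≤ √C * ‖ι ψ‖ := by
    intro i ψ
    have := hT.abs_integral_fderiv_le hΩ hwm ψ.2 (EuclideanSpace.single i 1)
    rw [hind] at this
    have hn : ‖ι ψ‖ = (eLpNorm ψ.1 2 (volume.restrict Ω)).toReal := Lp.norm_toLp _ (hmem ψ)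
    rw [hn]
    simpa [l] using this
  choose G hG using fun i => exists_inner_eq_of_abs_le ι (l i) (√C) (hl i)
  refine ⟨hwL, fun x => WithLp.toLp 2 fun i => -G i x, ?_, ?_⟩
  · exact MemLp.of_eval_piLp fun i => (Lp.memLp (G i)).neg
  · intro ψ hψ hψc hψΩ i
    have h1 := hG i ⟨ψ, hψ, hψc, hψΩ⟩
    change ∫ x in Ω, w x * fderiv ℝ ψ x (EuclideanSpace.single i 1) = _ at h1
    rw [h1, L2.inner_def, ← integral_neg]
    refine integral_congr_ae ?_
    filter_upwards [(hmem ⟨ψ, hψ, hψc, hψΩ⟩).coeFn_toLp] with x hx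
    have hι : ι ⟨ψ, hψ, hψc, hψΩ⟩ = (hmem ⟨ψ, hψ, hψc, hψΩ⟩).toLp ψ := rfl
    rw [hι, hx]
    simp [mul_comm]

end ShiftLipschitz

/-! ### Interactions between two sets. -/

/-- The integral of `|u x - u y|²` over pairs `(x, y) ∈ A × B`. -/
noncomputable def pairInt {d : ℕ} (u : Euc d → ℝ) (A B : Set (Euc d)) : ℝ≥0∞ :=
  ∫⁻ x in A, ∫⁻ y in B, ENNReal.ofReal ((u x - u y) ^ 2)

section PairInt

variable {d : ℕ} {u : Euc d → ℝ} {A B S : Set (Euc d)}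

theorem pairInt_comm (hu : Measurable u) : pairInt u A B = pairInt u B A := by
  unfold pairInt
  rw [lintegral_lintegral_swap (by fun_prop)]
  simp_rw [sub_sq_comm (u _) (u _)]

theorem pairInt_eq_setLIntegral_prod (hu : Measurable u) :
    pairInt u A B = ∫⁻ p in A ×ˢ B, ENNReal.ofReal ((u p.1 - u p.2) ^ 2) := by
  rw [Measure.volume_eq_prod, ← Measure.prod_restrict, lintegral_prod _ (by fun_prop)]
  rfl

theorem measurable_lintegral_sq_sub (hu : Measurable u) (B : Set (Euc d)) :
    Measurable fun x => ∫⁻ y in B, ENNReal.ofReal ((u x - u y) ^ 2) :=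
  Measurable.lintegral_prod_right' (f := fun p : Euc d × Euc d =>
    ENNReal.ofReal ((u p.1 - u p.2) ^ 2)) (by fun_prop)

/-- The triangle inequality through an intermediate point, averaged over that point in `B`: apply
`volume_mul_sqInt_le` to `z ↦ u x - u z` and integrate in `x`. It composes the links of a chain. -/
theorem volume_mul_pairInt_le (hu : Measurable u) :
    volume B * pairInt u A S ≤
      2 * (volume A * pairInt u B S) + 2 * (volume S * pairInt u A B) := by
  have h1 : ∀ x, volume B * ∫⁻ z in S, ENNReal.ofReal ((u x - u z) ^ 2) ≤
      2 * pairInt u B S + 2 * (volume S * ∫⁻ y in B, ENNReal.ofReal ((u x - u y) ^ 2)) := by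
    intro x
    have := volume_mul_sqInt_le (A := S) (B := B) (g := fun z => u x - u z) (by fun_prop)
    refine this.trans ?_
    rw [pairInt_comm hu]
    have h2 : ∀ z y, (u x - u z - (u x - u y)) ^ 2 = (u z - u y) ^ 2 := fun z y => by ring
    simp_rw [h2]
    exact le_rfl
  rw [pairInt, ← lintegral_const_mul _ (measurable_lintegral_sq_sub hu S)]
  refine (lintegral_mono h1).trans_eq ?_
  have hm := measurable_lintegral_sq_sub hu B
  rw [lintegral_add_left measurable_const, lintegral_const_mul _ (hm.const_mul _),
    lintegral_const_mul _ hm, setLIntegral_const, ← pairInt]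
  ring

/-- Jensen's inequality for the square, obtained from Cauchy–Schwarz on `A`. -/
theorem volume_mul_sq_average_sub_le (hu : IntegrableOn u A) (h0 : volume A ≠ 0)
    (ht : volume A ≠ ∞) (c : ℝ) :
    volume A * ENNReal.ofReal (((volume.real A)⁻¹ * (∫ x in A, u x) - c) ^ 2) ≤
      ∫⁻ x in A, ENNReal.ofReal ((u x - c) ^ 2) := by
  have : IsFiniteMeasure (volume.restrict A) := ⟨by simpa using ht.lt_top⟩
  set a := volume.real A with ha
  have ha0 : 0 < a := ENNReal.toReal_pos h0 ht
  have hA : volume A = ENNReal.ofReal a := (ENNReal.ofReal_toReal ht).symm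
  have h1 : a⁻¹ * (∫ x in A, u x) - c = a⁻¹ * ∫ x in A, (u x - c) := by
    rw [integral_sub hu (integrable_const c), setIntegral_const, smul_eq_mul, ← ha, mul_sub,
      inv_mul_cancel_left₀ ha0.ne']
  have h2 : ‖∫ x in A, (u x - c)‖ₑ ^ 2 ≤ sqInt A (fun x => u x - c) * volume A := by
    have h3 : ‖∫ x in A, (u x - c)‖ₑ ≤
        eLpNorm (fun x => u x - c) 2 (volume.restrict A) * volume A ^ (1 / 2 : ℝ) := by
      refine (enorm_integral_le_lintegral_enorm _).trans ?_
      rw [← eLpNorm_one_eq_lintegral_enorm]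
      refine (eLpNorm_le_eLpNorm_mul_rpow_measure_univ (p := 1) (q := 2) (by norm_num)
        (hu.sub (integrable_const c)).1).trans_eq ?_
      norm_num
      rfl
    refine (pow_le_pow_left' h3 2).trans_eq ?_
    rw [mul_pow, ← sqInt_eq_eLpNorm_sq, ← ENNReal.rpow_natCast (volume A ^ _), ← ENNReal.rpow_mul]
    norm_num
  have h4 : ENNReal.ofReal ((a⁻¹ * ∫ x in A, (u x - c)) ^ 2) =
      ENNReal.ofReal (a⁻¹ ^ 2) * ‖∫ x in A, (u x - c)‖ₑ ^ 2 := by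
    rw [mul_pow, ENNReal.ofReal_mul (by positivity), Real.enorm_eq_ofReal_abs,
      ← ENNReal.ofReal_pow (abs_nonneg _), sq_abs]
  rw [h1, h4]
  calc _ ≤ volume A * (ENNReal.ofReal (a⁻¹ ^ 2) * (sqInt A (fun x => u x - c) * volume A)) := by
        gcongr
    _ = ENNReal.ofReal (a * a⁻¹ ^ 2 * a) * sqInt A (fun x => u x - c) := by
        rw [hA, ENNReal.ofReal_mul (by positivity), ENNReal.ofReal_mul ha0.le]
        ring
    _ = _ := by
        rw [show a * a⁻¹ ^ 2 * a = 1 by field_simp]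
        simp [sqInt]

/-- Jensen's inequality once in each variable. -/
theorem volume_mul_sq_average_sub_average_le (hu : Measurable u) (hA : IntegrableOn u A)
    (hB : IntegrableOn u B) (hA0 : volume A ≠ 0) (hAt : volume A ≠ ∞) (hB0 : volume B ≠ 0)
    (hBt : volume B ≠ ∞) :
    volume B * (volume A * ENNReal.ofReal (((volume.real A)⁻¹ * (∫ x in A, u x) -
      (volume.real B)⁻¹ * ∫ x in B, u x) ^ 2)) ≤ pairInt u A B := by
  set mB := (volume.real B)⁻¹ * ∫ x in B, u x with hmB
  calc _ ≤ volume B * ∫⁻ x in A, ENNReal.ofReal ((u x - mB) ^ 2) := by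
        gcongr; exact volume_mul_sq_average_sub_le hA hA0 hAt mB
    _ = ∫⁻ x in A, volume B * ENNReal.ofReal ((mB - u x) ^ 2) := by
        rw [lintegral_const_mul _ (by fun_prop)]
        simp_rw [sub_sq_comm mB]
    _ ≤ _ := by
        refine lintegral_mono fun x => ?_
        refine (volume_mul_sq_average_sub_le hB hB0 hBt (u x)).trans_eq ?_
        simp_rw [sub_sq_comm (u x)]

end PairInt

/-! ### Scaled inclusions and control by the short-range energy. -/

section Inclusion

variable {d : ℕ} {K P Q S Ω : Set (Euc d)} {δ ρ : ℝ}

theorem latticePoint_add (k l : Fin d → ℤ) :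
    latticePoint (k + l) = latticePoint k + latticePoint l := by
  ext i; simp [latticePoint]

theorem mem_inclusion {k : Fin d → ℤ} {x : Euc d} :
    x ∈ inclusion P δ k ↔ ∃ y ∈ P, x = δ • (latticePoint k + y) := by
  simp only [_root_.inclusion, Set.mem_smul_set]
  constructor
  · rintro ⟨_, ⟨y, hy, rfl⟩, rfl⟩
    exact ⟨y, hy, rfl⟩
  · rintro ⟨y, hy, rfl⟩
    exact ⟨_, ⟨y, hy, rfl⟩, rfl⟩

theorem inclusion_vadd (m k : Fin d → ℤ) :
    inclusion (latticePoint m +ᵥ P) δ k = inclusion P δ (k + m) := by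
  simp [_root_.inclusion, latticePoint_add, vadd_vadd]

theorem inclusion_iUnion {ι : Type*} (P : ι → Set (Euc d)) (k : Fin d → ℤ) :
    inclusion (⋃ i, P i) δ k = ⋃ i, inclusion (P i) δ k := by
  simp [_root_.inclusion, Set.vadd_set_iUnion, Set.smul_set_iUnion]

theorem volume_inclusion (hδ : 0 < δ) (k : Fin d → ℤ) :
    volume (inclusion P δ k) = ENNReal.ofReal (δ ^ d) * volume P := by
  rw [_root_.inclusion, Measure.addHaar_smul, finrank_euclideanSpace_fin, abs_of_pos (by positivity),
    measure_vadd]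

theorem measurableSet_inclusion (hP : MeasurableSet P) (k : Fin d → ℤ) :
    MeasurableSet (inclusion P δ k) :=
  (hP.const_vadd _).const_smul₀ δ

theorem inclusion_subset_ball (hδ : 0 < δ) {R : ℝ} (hP : ∀ x ∈ P, ‖x‖ < R) (k : Fin d → ℤ) :
    inclusion P δ k ⊆ Metric.ball (δ • latticePoint k) (R * δ) := by
  intro x hx
  obtain ⟨y, hy, rfl⟩ := mem_inclusion.1 hx
  rw [Metric.mem_ball, smul_add, dist_self_add_left, norm_smul, Real.norm_eq_abs, abs_of_pos hδ,
    mul_comm]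
  exact mul_lt_mul_of_pos_right (hP y hy) hδ

/-- The energy of the interactions at distance less than `ρ * δ` in the inclusions of size `δ`. -/
noncomputable def shortRangeEnergy (Ω K : Set (Euc d)) (ρ δ : ℝ) (u : Euc d → ℝ) : ℝ≥0∞ :=
  ∫⁻ p in ((Ω ∩ δ • periodicSet K) ×ˢ (Ω ∩ δ • periodicSet K)) ∩
    {p : Euc d × Euc d | dist p.1 p.2 < ρ * δ}, ENNReal.ofReal ((u p.1 - u p.2) ^ 2)

/-- The interaction between the `δ`-scaled copies of `P` and `Q`, summed over the translates well
inside `Ω`, is controlled by the short-range energy, uniformly in `δ` and in the function. -/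
def Controlled (Ω K : Set (Euc d)) (ρ : ℝ) (P Q : Set (Euc d)) : Prop :=
  ∃ (C : ℝ≥0) (R : ℝ), ∀ δ : ℝ, 0 < δ → ∀ u : Euc d → ℝ, Measurable u →
    ∀ T : Finset (Fin d → ℤ), (∀ k ∈ T, Metric.ball (δ • latticePoint k) (R * δ) ⊆ Ω) →
      ∑ k ∈ T, pairInt u (inclusion P δ k) (inclusion Q δ k) ≤ C * shortRangeEnergy Ω K ρ δ u

theorem Controlled.symm (h : Controlled Ω K ρ P Q) : Controlled Ω K ρ Q P := by
  obtain ⟨C, R, h⟩ := h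
  refine ⟨C, R, fun δ hδ u hu T hT => ?_⟩
  simp_rw [pairInt_comm hu (A := inclusion Q δ _)]
  exact h δ hδ u hu T hT

theorem ball_mono_radius {x : Euc d} {R R' : ℝ} (hδ : 0 < δ) (h : R ≤ R') :
    Metric.ball x (R * δ) ⊆ Metric.ball x (R' * δ) :=
  Metric.ball_subset_ball (by gcongr)

/-- The three scaled volumes in `volume_mul_pairInt_le` carry the same factor `δ^d`, which cancels,
so the new constant is still independent of `δ`. Positive measure of the middle set is essential. -/
theorem Controlled.trans (hPQ : Controlled Ω K ρ P Q) (hQS : Controlled Ω K ρ Q S)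
    (hP : volume P ≠ ∞) (hQ : volume Q ≠ 0) (hQ' : volume Q ≠ ∞) (hS : volume S ≠ ∞) :
    Controlled Ω K ρ P S := by
  obtain ⟨C₁, R₁, h₁⟩ := hPQ
  obtain ⟨C₂, R₂, h₂⟩ := hQS
  set X : ℝ≥0∞ := (2 * (volume P * C₂) + 2 * (volume S * C₁)) / volume Q with hX
  have hXt : X ≠ ∞ := ENNReal.div_ne_top (by finiteness) hQ
  have hXQ : volume Q * X = 2 * (volume P * C₂) + 2 * (volume S * C₁) :=
    ENNReal.mul_div_cancel hQ hQ'
  refine ⟨X.toNNReal, max R₁ R₂, fun δ hδ u hu T hT => ?_⟩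
  have h₁' := h₁ δ hδ u hu T fun k hk => (ball_mono_radius hδ (le_max_left _ _)).trans (hT k hk)
  have h₂' := h₂ δ hδ u hu T fun k hk => (ball_mono_radius hδ (le_max_right _ _)).trans (hT k hk)
  set J := shortRangeEnergy Ω K ρ δ u
  set s := ENNReal.ofReal (δ ^ d) with hs
  have hs0 : s ≠ 0 := by simp only [hs, ne_eq, ENNReal.ofReal_eq_zero, not_le]; positivity
  have hst : s ≠ ∞ := ENNReal.ofReal_ne_top
  rw [ENNReal.coe_toNNReal hXt, ← ENNReal.mul_le_mul_iff_right (mul_ne_zero hs0 hQ)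
    (ENNReal.mul_ne_top hst hQ'), Finset.mul_sum]
  calc _ ≤ ∑ k ∈ T, (2 * (s * volume P * pairInt u (inclusion Q δ k) (inclusion S δ k)) +
        2 * (s * volume S * pairInt u (inclusion P δ k) (inclusion Q δ k))) := by
        refine Finset.sum_le_sum fun k _ => ?_
        have := volume_mul_pairInt_le hu (A := inclusion P δ k) (B := inclusion Q δ k)
          (S := inclusion S δ k)
        simpa only [volume_inclusion hδ] using this
    _ = 2 * (s * volume P * ∑ k ∈ T, pairInt u (inclusion Q δ k) (inclusion S δ k)) +
        2 * (s * volume S * ∑ k ∈ T, pairInt u (inclusion P δ k) (inclusion Q δ k)) := by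
        simp only [Finset.sum_add_distrib, Finset.mul_sum]
    _ ≤ 2 * (s * volume P * (C₂ * J)) + 2 * (s * volume S * (C₁ * J)) := by gcongr
    _ = s * (2 * (volume P * C₂) + 2 * (volume S * C₁)) * J := by ring
    _ = _ := by rw [← hXQ]; ring

theorem Controlled.iUnion_left {ι : Type*} [Finite ι] {P : ι → Set (Euc d)}
    (h : ∀ i, Controlled Ω K ρ (P i) Q) : Controlled Ω K ρ (⋃ i, P i) Q := by
  have := Fintype.ofFinite ι
  choose C R h using h
  obtain ⟨M, hM⟩ := (finite_range R).bddAbove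
  refine ⟨∑ i, C i, M, fun δ hδ u hu T hT => ?_⟩
  have h' := fun i => h i δ hδ u hu T fun k hk =>
    (ball_mono_radius hδ (hM (mem_range_self i))).trans (hT k hk)
  calc _ ≤ ∑ k ∈ T, ∑ i, pairInt u (inclusion (P i) δ k) (inclusion Q δ k) := by
        refine Finset.sum_le_sum fun k _ => ?_
        rw [inclusion_iUnion]
        exact (lintegral_iUnion_le _ _).trans_eq (tsum_fintype _)
    _ = ∑ i, ∑ k ∈ T, pairInt u (inclusion (P i) δ k) (inclusion Q δ k) := Finset.sum_comm
    _ ≤ ∑ i, C i * shortRangeEnergy Ω K ρ δ u := Finset.sum_le_sum fun i _ => h' i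
    _ = _ := by rw [← Finset.sum_mul]; push_cast; rfl

theorem pairwise_disjoint_inclusion (hK : IsInclusionShape K) (hδ : δ ≠ 0) {a : Fin d → ℤ}
    (hP : P ⊆ latticePoint a +ᵥ K) :
    Pairwise fun k l => Disjoint (inclusion P δ k) (inclusion P δ l) := by
  intro k l hkl
  rw [Set.disjoint_left]
  intro x hx hx'
  obtain ⟨y, hy, rfl⟩ := mem_inclusion.1 hx
  obtain ⟨y', hy', h⟩ := mem_inclusion.1 hx'
  obtain ⟨z, hz, rfl⟩ := hP hy
  obtain ⟨z', hz', rfl⟩ := hP hy'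
  have h1 := smul_right_injective _ hδ h
  simp only [vadd_eq_add] at h1
  refine Set.disjoint_left.1 (hK.disjoint_translate (k - l) (sub_ne_zero.2 hkl)) ⟨z, hz, ?_⟩ hz'
  have h2 : latticePoint (k - l) + latticePoint l = latticePoint k := by
    rw [← latticePoint_add, sub_add_cancel]
  rw [← h2] at h1
  have h3 : latticePoint (k - l) + z = z' := by
    have : latticePoint (k - l) + z + (latticePoint l + latticePoint a) =
        z' + (latticePoint l + latticePoint a) := by
      rw [show latticePoint (k - l) + z + (latticePoint l + latticePoint a) =
        latticePoint (k - l) + latticePoint l + (latticePoint a + z) by abel, h1]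
      abel
    exact add_right_cancel this
  exact h3

/-- The base case, with constant `1`: the products of scaled copies are disjoint for different `k`
and all lie in the domain of integration of `shortRangeEnergy`. The radius `R₁ + 1` keeps the copies
inside `Ω`. -/
theorem Controlled.of_dist_lt (hK : IsInclusionShape K) {a b : Fin d → ℤ}
    (hPm : MeasurableSet P) (hQm : MeasurableSet Q) (hP : P ⊆ latticePoint a +ᵥ K)
    (hQ : Q ⊆ latticePoint b +ᵥ K) (hPQ : ∀ x ∈ P, ∀ y ∈ Q, dist x y < ρ) :
    Controlled Ω K ρ P Q := by
  have hbd : ∀ c : Fin d → ℤ, Bornology.IsBounded (latticePoint c +ᵥ K) := fun c =>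
    (hK.isCompact.vadd _).isBounded
  obtain ⟨R₁, hR₁⟩ := (((hbd a).subset hP).union ((hbd b).subset hQ)).exists_norm_le
  have hR : ∀ x ∈ P ∪ Q, ‖x‖ < R₁ + 1 := fun x hx => (hR₁ x hx).trans_lt (lt_add_one _)
  refine ⟨1, R₁ + 1, fun δ hδ u hu T hT => ?_⟩
  simp_rw [pairInt_eq_setLIntegral_prod hu]
  rw [← lintegral_biUnion_finset, ENNReal.coe_one, one_mul]
  · refine lintegral_mono_set (iUnion₂_subset fun k hk => ?_)
    rintro ⟨x, y⟩ ⟨hx, hy⟩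
    have hper : ∀ {P' : Set (Euc d)} {c : Fin d → ℤ}, P' ⊆ latticePoint c +ᵥ K →
        ∀ x ∈ inclusion P' δ k, x ∈ δ • periodicSet K := by
      intro P' c hP' x hx
      obtain ⟨y, hy, rfl⟩ := mem_inclusion.1 hx
      obtain ⟨z, hz, rfl⟩ := hP' hy
      refine Set.smul_mem_smul_set (mem_iUnion.2 ⟨k + c, z, hz, ?_⟩)
      simp [latticePoint_add, add_assoc]
    refine ⟨⟨⟨?_, hper hP x hx⟩, ?_, hper hQ y hy⟩, ?_⟩
    · exact hT k hk (inclusion_subset_ball hδ (fun z hz => hR z (Or.inl hz)) k hx)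
    · exact hT k hk (inclusion_subset_ball hδ (fun z hz => hR z (Or.inr hz)) k hy)
    · obtain ⟨x', hx', rfl⟩ := mem_inclusion.1 hx
      obtain ⟨y', hy', rfl⟩ := mem_inclusion.1 hy
      change dist _ _ < _
      rw [dist_smul₀, dist_add_left, Real.norm_eq_abs, abs_of_pos hδ, mul_comm]
      exact mul_lt_mul_of_pos_right (hPQ _ hx' _ hy') hδ
  · intro k _ l _ hkl
    exact Set.disjoint_prod.2 (Or.inl (pairwise_disjoint_inclusion hK hδ.ne' hP hkl))
  · exact fun k _ => (measurableSet_inclusion hPm k).prod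
      (measurableSet_inclusion hQm k)

end Inclusion

/-! ### Chains of inclusions from connectedness. -/

/-- If a union of nonempty open sets is connected, then any two of them are joined by a chain of
successively overlapping ones. -/
theorem reflTransGen_of_isPreconnected_iUnion {ι X : Type*} [TopologicalSpace X] {V : ι → Set X}
    (ho : ∀ i, IsOpen (V i)) (hne : ∀ i, (V i).Nonempty) (hc : IsPreconnected (⋃ i, V i))
    (i j : ι) : Relation.ReflTransGen (fun i j => (V i ∩ V j).Nonempty) i j := by
  by_contra hij
  set r : ι → Prop := Relation.ReflTransGen (fun i j => (V i ∩ V j).Nonempty) i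
  have h := hc (⋃ k, ⋃ _ : r k, V k) (⋃ k, ⋃ _ : ¬r k, V k)
    (isOpen_iUnion fun k => isOpen_iUnion fun _ => ho k)
    (isOpen_iUnion fun k => isOpen_iUnion fun _ => ho k)
    (iUnion_subset fun k x hx => ?_) ?_ ?_
  · obtain ⟨x, -, h1, h2⟩ := h
    obtain ⟨k, hk, hxk⟩ := mem_iUnion₂.1 h1
    obtain ⟨l, hl, hxl⟩ := mem_iUnion₂.1 h2
    exact hl (hk.tail ⟨x, hxk, hxl⟩)
  · by_cases hk : r k
    · exact Or.inl (mem_iUnion₂.2 ⟨k, hk, hx⟩)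
    · exact Or.inr (mem_iUnion₂.2 ⟨k, hk, hx⟩)
  · obtain ⟨x, hx⟩ := hne i
    exact ⟨x, mem_iUnion.2 ⟨i, hx⟩, mem_iUnion₂.2 ⟨i, .refl, hx⟩⟩
  · obtain ⟨x, hx⟩ := hne j
    exact ⟨x, mem_iUnion.2 ⟨j, hx⟩, mem_iUnion₂.2 ⟨j, hij, hx⟩⟩

section Connection

variable {d : ℕ} {K Ω : Set (Euc d)} {r ρ : ℝ}

/-- `K` is the closure of an open set, so each ball centred in `K` meets that open set. This gives
every piece of a chain positive measure. -/
theorem IsInclusionShape.measure_inter_ball_pos (hK : IsInclusionShape K) {c : Euc d} (hc : c ∈ K)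
    {η : ℝ} (hη : 0 < η) : 0 < volume (K ∩ Metric.ball c η) := by
  obtain ⟨U, hU, -, rfl⟩ := hK.eq_closure
  have hne : (Metric.ball c η ∩ U).Nonempty :=
    mem_closure_iff.1 hc _ Metric.isOpen_ball (Metric.mem_ball_self hη)
  refine ((Metric.isOpen_ball.inter hU).measure_pos volume hne).trans_le (measure_mono ?_)
  rw [inter_comm]
  exact inter_subset_inter_left _ subset_closure

theorem IsInclusionShape.nonempty (hK : IsInclusionShape K) : K.Nonempty := by
  obtain ⟨U, -, hU, rfl⟩ := hK.eq_closure
  exact hU.nonempty.closure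

theorem IsInclusionShape.measure_pos (hK : IsInclusionShape K) : 0 < volume K := by
  obtain ⟨c, hc⟩ := hK.nonempty
  exact (hK.measure_inter_ball_pos hc one_pos).trans_le (measure_mono inter_subset_left)

/-- If the `r / 2`-neighbourhood of the periodic set is connected and `r < ρ`, then the interaction
of any two inclusions is controlled by the interactions at distance less than `ρ`. -/
theorem controlled_vadd (hK : IsInclusionShape K) (hr : 0 < r) (hrρ : r < ρ)
    (hconn : IsConnected (periodicSet K + Metric.ball (0 : Euc d) (r / 2))) (m : Fin d → ℤ) :
    Controlled Ω K ρ K (latticePoint m +ᵥ K) := by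
  -- Pieces have diameter at most `2 * η`, and neighbouring pieces contain points less than `r`
  -- apart; so all their pairs are less than `r + 4 * η = ρ` apart.
  set η := (ρ - r) / 4 with hηdef
  have hη : 0 < η := by rw [hηdef]; linarith
  obtain ⟨t, htK, htf, ht⟩ := hK.isCompact.finite_cover_balls hη
  have : Finite t := htf
  -- the pieces of the inclusions
  set P : (Fin d → ℤ) × t → Set (Euc d) :=
    fun q => latticePoint q.1 +ᵥ (K ∩ Metric.ball (q.2 : Euc d) η) with hP
  have hPK : ∀ q, P q ⊆ latticePoint q.1 +ᵥ K := fun q =>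
    Set.vadd_set_mono inter_subset_left
  have hPm : ∀ q, MeasurableSet (P q) := fun q =>
    (hK.isCompact.measurableSet.inter Metric.isOpen_ball.measurableSet).const_vadd _
  have hP0 : ∀ q, volume (P q) ≠ 0 := fun q => by
    rw [hP, measure_vadd]
    exact (hK.measure_inter_ball_pos (htK q.2.2) hη).ne'
  have hPt : ∀ q, volume (P q) ≠ ∞ := fun q =>
    ((measure_mono (hPK q)).trans_lt (by
      rw [measure_vadd]; exact hK.isCompact.measure_lt_top)).ne
  have hPd : ∀ q, ∀ x ∈ P q, ∀ y ∈ P q, dist x y < 2 * η := by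
    rintro q _ ⟨x, hx, rfl⟩ _ ⟨y, hy, rfl⟩
    simp only [vadd_eq_add, dist_add_left]
    have h1 := Metric.mem_ball.1 hx.2
    have h2 := Metric.mem_ball.1 hy.2
    linarith [dist_triangle_right x y q.2]
  have hKP : ∀ k, ⋃ c : t, P (k, c) = latticePoint k +ᵥ K := by
    intro k
    refine subset_antisymm (iUnion_subset fun c => hPK _) ?_
    rintro _ ⟨x, hx, rfl⟩
    obtain ⟨c, hc, hxc⟩ := mem_iUnion₂.1 (ht hx)
    exact mem_iUnion.2 ⟨⟨c, hc⟩, x, ⟨hx, hxc⟩, rfl⟩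
  have hunion : ⋃ q, (P q + Metric.ball (0 : Euc d) (r / 2)) =
      periodicSet K + Metric.ball (0 : Euc d) (r / 2) := by
    rw [← Set.iUnion_add, iUnion_prod']
    simp_rw [hKP]
    rfl
  have hadj : ∀ p q, ((P p + Metric.ball (0 : Euc d) (r / 2)) ∩
      (P q + Metric.ball (0 : Euc d) (r / 2))).Nonempty → Controlled Ω K ρ (P p) (P q) := by
    rintro p q ⟨_, ⟨x, hx, a, ha, rfl⟩, ⟨y, hy, b, hb, hxy⟩⟩
    refine Controlled.of_dist_lt hK (hPm p) (hPm q) (hPK p) (hPK q) fun x' hx' y' hy' => ?_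
    have h1 := hPd p x' hx' x hx
    have h2 := hPd q y hy y' hy'
    have h3 : dist x y < r := by
      rw [mem_ball_zero_iff] at ha hb
      have : x - y = b - a := by
        rw [sub_eq_sub_iff_add_eq_add, add_comm b y]
        exact hxy.symm
      rw [dist_eq_norm, this]
      exact (norm_sub_le _ _).trans_lt (by linarith)
    have h4 := dist_triangle4 x' x y y'
    rw [hηdef] at h1 h2
    linarith
  have hchain : ∀ p q, Controlled Ω K ρ (P p) (P q) := by
    intro p q
    have hne : ∀ q, (P q + Metric.ball (0 : Euc d) (r / 2)).Nonempty := fun q =>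
      (nonempty_of_measure_ne_zero (hP0 q)).add ⟨0, Metric.mem_ball_self (by positivity)⟩
    have hrt := reflTransGen_of_isPreconnected_iUnion
      (V := fun q => P q + Metric.ball (0 : Euc d) (r / 2))
      (fun q => Metric.isOpen_ball.add_left) hne (hunion ▸ hconn.isPreconnected) p q
    induction hrt with
    | refl => exact hadj p p (by rw [inter_self]; exact hne p)
    | tail _ h ih => exact ih.trans (hadj _ _ h) (hPt _) (hP0 _) (hPt _) (hPt _)
  have h0 : (latticePoint 0 : Euc d) +ᵥ K = K := by
    have : (latticePoint 0 : Euc d) = 0 := by ext i; simp [latticePoint]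
    rw [this, zero_vadd]
  have h : Controlled Ω K ρ (⋃ c, P (0, c)) (⋃ c, P (m, c)) :=
    Controlled.iUnion_left fun c => (Controlled.iUnion_left fun c' => hchain (m, c') (0, c)).symm
  rwa [hKP, hKP, h0] at h

/-- The neighbourhoods of the periodic set of large radius are connected. -/
theorem exists_isConnected_periodicSet_add_ball (hK : IsInclusionShape K) :
    ∃ r > 0, IsConnected (periodicSet K + Metric.ball (0 : Euc d) (r / 2)) := by
  obtain ⟨c, hc⟩ := hK.nonempty
  refine ⟨2 * (d + 1), by positivity, ?_⟩
  have : periodicSet K + Metric.ball (0 : Euc d) (2 * (d + 1) / 2) = univ := by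
    refine eq_univ_of_forall fun x => ?_
    -- The fractional parts of the coordinates of `x - c` form a vector of norm at most `d`, less
    -- than the radius `d + 1`.
    refine ⟨latticePoint (fun i => ⌊(x - c) i⌋) + c, mem_iUnion.2 ⟨_, c, hc, rfl⟩,
      x - (latticePoint (fun i => ⌊(x - c) i⌋) + c), ?_, by simp⟩
    rw [mem_ball_zero_iff]
    refine (norm_le_of_forall_abs_le zero_le_one fun i => ?_).trans_lt (by linarith)
    have h1 : (x - (latticePoint (fun i => ⌊(x - c) i⌋) + c)) i = Int.fract ((x - c) i) := by
      simp only [latticePoint, PiLp.sub_apply, PiLp.add_apply, Int.fract]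
      ring
    rw [h1, abs_of_nonneg (Int.fract_nonneg _)]
    exact (Int.fract_lt_one _).le
  rw [this]
  exact isConnected_univ

theorem measurableSet_smul_periodicSet (hK : IsInclusionShape K) (δ : ℝ) :
    MeasurableSet (δ • periodicSet K) :=
  (MeasurableSet.iUnion fun _ => hK.isCompact.measurableSet.const_vadd _).const_smul₀ δ

/-- The short-range energy is bounded by the energy, if the kernel is bounded below at short
range. -/
theorem shortRangeEnergy_le (hΩ : IsOpen Ω) (hK : IsInclusionShape K) {φ₀ : ℝ≥0 → ℝ≥0} {c : ℝ≥0}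
    {δ ε : ℝ} (hε : 0 < ε) (hc : ∀ s : ℝ≥0, s * ε < ρ * δ → c ≤ φ₀ s) (u : Euc d → ℝ) :
    c * shortRangeEnergy Ω K ρ δ u ≤ ENNReal.ofReal (ε ^ (d + 2)) * energy Ω K φ₀ δ ε u := by
  set O := Ω ∩ δ • periodicSet K with hO
  have hOm : MeasurableSet O := hΩ.measurableSet.inter (measurableSet_smul_periodicSet hK δ)
  have hSm : MeasurableSet ((O ×ˢ O) ∩ {p : Euc d × Euc d | dist p.1 p.2 < ρ * δ}) :=
    (hOm.prod hOm).inter (measurableSet_lt (by fun_prop) measurable_const)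
  have h1 : ENNReal.ofReal ((ε ^ d)⁻¹ * c) * shortRangeEnergy Ω K ρ δ u ≤
      ∫⁻ p in O ×ˢ O, ENNReal.ofReal (scaledKernel d φ₀ ε (p.1 - p.2) * |u p.1 - u p.2| ^ 2) := by
    rw [shortRangeEnergy, ← lintegral_const_mul' _ _ ENNReal.ofReal_ne_top]
    refine (setLIntegral_mono' hSm ?_).trans (lintegral_mono_set inter_subset_left)
    rintro ⟨x, y⟩ ⟨-, hxy⟩
    rw [← ENNReal.ofReal_mul (by positivity), sq_abs]
    refine ENNReal.ofReal_le_ofReal ?_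
    rw [scaledKernel, radialKernel]
    have h2 : c ≤ φ₀ ‖ε⁻¹ • (x - y)‖₊ := by
      refine hc _ ?_
      rw [coe_nnnorm, norm_smul, norm_inv, Real.norm_eq_abs, abs_of_pos hε, ← dist_eq_norm,
        mul_comm, mul_inv_cancel_left₀ hε.ne']
      exact hxy
    gcongr
  rw [energy, ← hO]
  calc (c : ℝ≥0∞) * shortRangeEnergy Ω K ρ δ u
      = ENNReal.ofReal (ε ^ (d + 2)) * (ENNReal.ofReal (ε ^ 2)⁻¹ *
        (ENNReal.ofReal ((ε ^ d)⁻¹ * c) * shortRangeEnergy Ω K ρ δ u)) := by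
        rw [← mul_assoc, ← mul_assoc, ← ENNReal.ofReal_mul (by positivity),
          ← ENNReal.ofReal_mul (by positivity)]
        rw [show ε ^ (d + 2) * (ε ^ 2)⁻¹ * ((ε ^ d)⁻¹ * c) = c by
          rw [pow_add]; field_simp, ENNReal.ofReal_coe_nnreal]
    _ ≤ _ := by gcongr

end Connection

/-! ### Oscillation of the means over neighbouring inclusions. -/

/-- The sum of the squared increments of a lattice function at `k`, over the shifts in
`{-1, 0, 1}^d`. -/
noncomputable def localOsc {d : ℕ} (v : (Fin d → ℤ) → ℝ) (k : Fin d → ℤ) : ℝ :=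
  ∑ m ∈ Fintype.piFinset fun _ : Fin d => Finset.Icc (-1 : ℤ) 1, (v (k + m) - v k) ^ 2

section LocalOsc

variable {d : ℕ} {Ω K : Set (Euc d)} {v : (Fin d → ℤ) → ℝ} {δ ρ r : ℝ}

theorem sq_sub_le_localOsc (v : (Fin d → ℤ) → ℝ) (k m : Fin d → ℤ) (hm : ∀ i, |m i| ≤ 1) :
    (v (k + m) - v k) ^ 2 ≤ localOsc v k :=
  Finset.single_le_sum (f := fun m => (v (k + m) - v k) ^ 2) (fun _ _ => sq_nonneg _)
    (Fintype.mem_piFinset.2 fun i => Finset.mem_Icc.2 (abs_le.1 (hm i)))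

theorem localOsc_nonneg (v : (Fin d → ℤ) → ℝ) (k : Fin d → ℤ) : 0 ≤ localOsc v k :=
  Finset.sum_nonneg fun _ _ => sq_nonneg _

theorem abs_floor_sub_floor_le {a b : ℝ} (h : |b - a| ≤ 1) : |⌊b⌋ - ⌊a⌋| ≤ 1 := by
  rw [abs_le] at h ⊢
  constructor
  · have : ⌊a - 1⌋ ≤ ⌊b⌋ := Int.floor_le_floor (by linarith)
    rw [Int.floor_sub_one] at this
    linarith
  · have : ⌊b⌋ ≤ ⌊a + 1⌋ := Int.floor_le_floor (by linarith)
    rw [Int.floor_add_one] at this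
    linarith

/-- A shift of length at most `δ` changes each coordinate of the cell index by at most one. -/
theorem sq_comp_cellIndex_sub_le (hδ : 0 < δ) (v : (Fin d → ℤ) → ℝ) (y : Euc d) {s : Euc d}
    (hs : ‖s‖ ≤ δ) :
    (v (cellIndex δ (y + s)) - v (cellIndex δ y)) ^ 2 ≤ localOsc v (cellIndex δ y) := by
  have h := sq_sub_le_localOsc v (cellIndex δ y) (cellIndex δ (y + s) - cellIndex δ y) fun i => by
    refine abs_floor_sub_floor_le ?_
    rw [← sub_div, PiLp.add_apply, add_sub_cancel_left, abs_div, abs_of_pos hδ, div_le_one hδ]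
    exact (PiLp.norm_apply_le s i).trans hs
  rwa [add_sub_cancel] at h

/-- The difference is a sum of `d` terms, each a weight in `[0, 1]` times a difference of two vertex
values. Each vertex value is within `√(localOsc v k)` of `v k`, so each squared term is at most `4 *
localOsc v k`, and Cauchy–Schwarz gives `4 d²`. -/
theorem sq_kuhnInterpolation_sub_le (δ : ℝ) (v : (Fin d → ℤ) → ℝ) (x : Euc d) :
    (kuhnInterpolation δ v x - v (cellIndex δ x)) ^ 2 ≤
      4 * d ^ 2 * localOsc v (cellIndex δ x) := by
  set k := cellIndex δ x
  set σ : Equiv.Perm (Fin d) := Tuple.sort fun i => -Int.fract (x i / δ)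
  have hvert : ∀ j, (v (k + kuhnVertex σ j) - v k) ^ 2 ≤ localOsc v k := fun j =>
    sq_sub_le_localOsc v k _ fun i => by
      unfold kuhnVertex
      split_ifs <;> simp
  have h1 : kuhnInterpolation δ v x - v k = ∑ j : Fin d, Int.fract (x (σ j) / δ) *
      (v (k + kuhnVertex σ (j + 1)) - v (k + kuhnVertex σ j)) := add_sub_cancel_left _ _
  have h2 : ∀ j : Fin d, (Int.fract (x (σ j) / δ) *
      (v (k + kuhnVertex σ (j + 1)) - v (k + kuhnVertex σ j))) ^ 2 ≤ 4 * localOsc v k := by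
    intro j
    have ha := hvert (j + 1)
    have hb := hvert j
    set a := v (k + kuhnVertex σ (j + 1))
    set b := v (k + kuhnVertex σ j)
    have ht : Int.fract (x (σ j) / δ) ^ 2 ≤ 1 :=
      pow_le_one₀ (Int.fract_nonneg _) (Int.fract_lt_one _).le
    calc _ = Int.fract (x (σ j) / δ) ^ 2 * (a - b) ^ 2 := by ring
      _ ≤ 1 * (a - b) ^ 2 := by gcongr
      _ ≤ 2 * (a - v k) ^ 2 + 2 * (b - v k) ^ 2 := by nlinarith [sq_nonneg (a + b - 2 * v k)]
      _ ≤ _ := by linarith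
  rw [h1]
  refine sq_sum_le_card_mul_sum_sq.trans ?_
  calc _ ≤ ((Finset.univ : Finset (Fin d)).card : ℝ) * ∑ j : Fin d, 4 * localOsc v k := by
        gcongr with j; exact h2 j
    _ = _ := by
        simp only [Finset.sum_const, Finset.card_univ, Fintype.card_fin, nsmul_eq_mul]
        ring

theorem volume_sq_mul_sq_inclusionMean_sub_le (hK : IsInclusionShape K) (hδ : 0 < δ)
    {u : Euc d → ℝ} (hu : Measurable u) (hui : IntegrableOn u Ω) {k l : Fin d → ℤ}
    (hk : inclusion K δ k ⊆ Ω) (hl : inclusion K δ l ⊆ Ω) :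
    (ENNReal.ofReal (δ ^ d) * volume K) ^ 2 *
      ENNReal.ofReal ((inclusionMean Ω K δ u l - inclusionMean Ω K δ u k) ^ 2) ≤
        pairInt u (inclusion K δ k) (inclusion K δ l) := by
  have hs0 : ENNReal.ofReal (δ ^ d) ≠ 0 := by
    simp only [ne_eq, ENNReal.ofReal_eq_zero, not_le]; positivity
  have hKt : volume K ≠ ∞ := hK.isCompact.measure_lt_top.ne
  have h0 : ∀ k, volume (inclusion K δ k) ≠ 0 := fun k => by
    rw [volume_inclusion hδ]; exact mul_ne_zero hs0 hK.measure_pos.ne'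
  have ht : ∀ k, volume (inclusion K δ k) ≠ ∞ := fun k => by
    rw [volume_inclusion hδ]; exact ENNReal.mul_ne_top ENNReal.ofReal_ne_top hKt
  have hreal : ∀ k, δ ^ d * volume.real K = volume.real (inclusion K δ k) := fun k => by
    rw [Measure.real, Measure.real, volume_inclusion hδ, ENNReal.toReal_mul,
      ENNReal.toReal_ofReal (by positivity)]
  have h := volume_mul_sq_average_sub_average_le hu (hui.mono_set hk) (hui.mono_set hl) (h0 k)
    (ht k) (h0 l) (ht l)
  rw [inclusionMean, inclusionMean, if_pos hk, if_pos hl, sub_sq_comm]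
  nth_rewrite 1 [hreal k]
  rw [hreal l]
  refine le_trans (le_of_eq ?_) h
  rw [volume_inclusion hδ, volume_inclusion hδ]
  ring

/-- The mean oscillation of the averages over neighbouring inclusions is controlled by the
short-range energy. -/
theorem exists_lintegral_localOsc_le (hK : IsInclusionShape K) (hr : 0 < r) (hrρ : r < ρ)
    (hconn : IsConnected (periodicSet K + Metric.ball (0 : Euc d) (r / 2))) :
    ∃ (C : ℝ≥0) (R : ℝ), ∀ δ : ℝ, 0 < δ → ∀ u : Euc d → ℝ, Measurable u → IntegrableOn u Ω →
      ENNReal.ofReal (δ ^ d) * ∫⁻ y in {y | Metric.ball y (R * δ) ⊆ Ω},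
        ENNReal.ofReal (localOsc (inclusionMean Ω K δ u) (cellIndex δ y)) ≤
          C * shortRangeEnergy Ω K ρ δ u := by
  set M := Fintype.piFinset fun _ : Fin d => Finset.Icc (-1 : ℤ) 1 with hM
  choose C R hCR using fun m : M => controlled_vadd (Ω := Ω) hK hr hrρ hconn m
  obtain ⟨R₁, hR₁⟩ := (finite_range R).bddAbove
  have hbd : Bornology.IsBounded (K ∪ ⋃ m : M, latticePoint (m : Fin d → ℤ) +ᵥ K) :=
    (hK.isCompact.union (isCompact_iUnion fun m => hK.isCompact.vadd _)).isBounded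
  obtain ⟨R₂, hR₂⟩ := hbd.exists_norm_le
  set R₃ := max R₁ (R₂ + 1) with hR₃
  have hKt : volume K ≠ ∞ := hK.isCompact.measure_lt_top.ne
  have hK0 := hK.measure_pos.ne'
  set X : ℝ≥0∞ := ((∑ m, C m : ℝ≥0) : ℝ≥0∞) / volume K ^ 2 with hX
  have hXt : X ≠ ∞ := ENNReal.div_ne_top (by simp) (pow_ne_zero 2 hK0)
  -- `R₃` keeps the neighbouring inclusions in `Ω` and meets the requirements of all the `R m`; the
  -- extra `d` covers the distance from `y` to the corner of its cell.
  refine ⟨X.toNNReal, R₃ + d, fun δ hδ u hu hui => ?_⟩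
  set J := shortRangeEnergy Ω K ρ δ u
  set v := inclusionMean Ω K δ u
  set s := ENNReal.ofReal (δ ^ d) with hs
  set G : Set (Fin d → ℤ) := {k | Metric.ball (δ • latticePoint k) (R₃ * δ) ⊆ Ω} with hG
  rw [ENNReal.coe_toNNReal hXt]
  have hincl : ∀ k ∈ G, ∀ Q ⊆ K ∪ ⋃ m : M, latticePoint (m : Fin d → ℤ) +ᵥ K,
      inclusion Q δ k ⊆ Ω := fun k hk Q hQ =>
    (inclusion_subset_ball hδ (fun x hx => (hR₂ x (hQ hx)).trans_lt (lt_add_one _)) k).trans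
      ((ball_mono_radius hδ (le_max_right _ _)).trans hk)
  have hsum : ∀ T : Finset (Fin d → ℤ), (∀ k ∈ T, k ∈ G) →
      s ^ 2 * ∑ k ∈ T, ENNReal.ofReal (localOsc v k) ≤ X * J := by
    intro T hT
    have h1 : ∀ m : M, ∑ k ∈ T, (s * volume K) ^ 2 *
        ENNReal.ofReal ((v (k + m) - v k) ^ 2) ≤ C m * J := by
      intro m
      refine le_trans (Finset.sum_le_sum fun k hk => ?_) (hCR m δ hδ u hu T fun k hk =>
        (ball_mono_radius hδ ((hR₁ (mem_range_self m)).trans (le_max_left _ _))).trans (hT k hk))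
      rw [inclusion_vadd]
      refine volume_sq_mul_sq_inclusionMean_sub_le hK hδ hu hui
        (hincl k (hT k hk) K subset_union_left) ?_
      rw [← inclusion_vadd]
      exact hincl k (hT k hk) _ (subset_union_of_subset_right
        (subset_iUnion (fun m : M => latticePoint (m : Fin d → ℤ) +ᵥ K) m) _)
    have h2 : ∀ k, ENNReal.ofReal (localOsc v k) =
        ∑ m : M, ENNReal.ofReal ((v (k + m) - v k) ^ 2) := fun k => by
      rw [localOsc, ENNReal.ofReal_sum_of_nonneg fun _ _ => sq_nonneg _,
        ← Finset.sum_coe_sort M fun m => ENNReal.ofReal ((v (k + m) - v k) ^ 2)]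
    have h3 : volume K ^ 2 * (s ^ 2 * ∑ k ∈ T, ENNReal.ofReal (localOsc v k)) ≤
        volume K ^ 2 * (X * J) := by
      calc _ = ∑ m : M, ∑ k ∈ T, (s * volume K) ^ 2 *
            ENNReal.ofReal ((v (k + m) - v k) ^ 2) := by
            simp_rw [h2]
            rw [Finset.sum_comm]
            simp only [Finset.mul_sum]
            refine Finset.sum_congr rfl fun m _ => Finset.sum_congr rfl fun k _ => ?_
            ring
        _ ≤ ∑ m : M, C m * J := Finset.sum_le_sum fun m _ => h1 m
        _ = _ := by
            rw [← mul_assoc, hX, ENNReal.mul_div_cancel (pow_ne_zero 2 hK0)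
              (ENNReal.pow_ne_top hKt), ← Finset.sum_mul]
            push_cast
            rfl
    rwa [ENNReal.mul_le_mul_iff_right (pow_ne_zero 2 hK0) (ENNReal.pow_ne_top hKt)] at h3
  have hcov : {y | Metric.ball y ((R₃ + d) * δ) ⊆ Ω} ⊆ ⋃ k : G, cell δ (k : Fin d → ℤ) := by
    intro y hy
    refine mem_iUnion.2 ⟨⟨cellIndex δ y, ?_⟩, rfl⟩
    refine (Metric.ball_subset_ball' ?_).trans hy
    have h1 : dist (δ • latticePoint (cellIndex δ y)) y ≤ d * δ := by
      refine dist_le_of_mem_cell hδ (k := cellIndex δ y) ?_ rfl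
      ext i
      simp [cellIndex, latticePoint, hδ.ne']
    rw [add_mul]
    linarith
  have hcell : ∀ k, ∫⁻ y in cell δ k, ENNReal.ofReal (localOsc v (cellIndex δ y)) =
      s * ENNReal.ofReal (localOsc v k) := by
    intro k
    rw [setLIntegral_congr_fun (measurableSet_cell δ k)
      (g := fun _ => ENNReal.ofReal (localOsc v k)) (fun y hy => by
        have : cellIndex δ y = k := hy
        simp only [this]), setLIntegral_const, volume_cell hδ, mul_comm, hs,
      ENNReal.ofReal_pow hδ.le]
  -- One factor `s = δ^d` is the prefactor, the other is the cell volume; together they match the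
  -- two inclusion volumes in the bound for the means.
  calc _ ≤ s * ∑' k : G, s * ENNReal.ofReal (localOsc v k) := by
        gcongr
        refine (lintegral_mono_set hcov).trans ((lintegral_iUnion_le _ _).trans_eq ?_)
        simp_rw [hcell]
    _ = ∑' k : G, s ^ 2 * ENNReal.ofReal (localOsc v k) := by
        rw [← ENNReal.tsum_mul_left]
        simp_rw [sq, mul_assoc]
    _ ≤ X * J := by
        rw [ENNReal.tsum_eq_iSup_sum]
        refine iSup_le fun T => ?_
        have h := hsum (T.map (Function.Embedding.subtype _)) fun k hk => ?_
        · rwa [Finset.sum_map, Finset.mul_sum] at h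
        obtain ⟨k', -, rfl⟩ := Finset.mem_map.1 hk
        exact k'.2

end LocalOsc

/-! ### From the oscillation bound to the interpolations. -/

section Interpolation

variable {d : ℕ} {Ω K : Set (Euc d)} {δ : ℕ → ℝ} {v : ℕ → (Fin d → ℤ) → ℝ} {R : ℝ} {C : ℝ≥0}

theorem shiftBounded_comp_cellIndex (hδ : ∀ n, 0 < δ n) (hδ0 : Tendsto δ atTop (𝓝 0))
    (hosc : ∀ n, ∫⁻ y in {y | Metric.ball y (R * δ n) ⊆ Ω},
      ENNReal.ofReal (localOsc (v n) (cellIndex (δ n) y)) ≤ C * ENNReal.ofReal (δ n ^ 2)) :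
    ShiftBounded Ω δ R C fun n x => v n (cellIndex (δ n) x) where
  pos := hδ
  tendsto := hδ0
  measurable _ := measurable_comp_cellIndex _ _
  bound n _ hs := (lintegral_mono fun y => ENNReal.ofReal_le_ofReal
    (sq_comp_cellIndex_sub_le (hδ n) (v n) y hs)).trans (hosc n)

/-- The piecewise-affine and the piecewise-constant interpolations have the same limits. -/
theorem tendstoL2Loc_kuhnInterpolation_iff (hΩ : IsOpen Ω) (hδ : ∀ n, 0 < δ n)
    (hδ0 : Tendsto δ atTop (𝓝 0))
    (hosc : ∀ n, ∫⁻ y in {y | Metric.ball y (R * δ n) ⊆ Ω},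
      ENNReal.ofReal (localOsc (v n) (cellIndex (δ n) y)) ≤ C * ENNReal.ofReal (δ n ^ 2))
    (c : ℕ → ℝ) (w : Euc d → ℝ) :
    TendstoL2Loc Ω (fun n x => kuhnInterpolation (δ n) (v n) x + c n) w ↔
      TendstoL2Loc Ω (fun n x => v n (cellIndex (δ n) x) + c n) w := by
  have hg := shiftBounded_comp_cellIndex hδ hδ0 hosc
  have hdiff : ∀ D, IsCompact D → D ⊆ Ω → Tendsto (fun n => sqInt D fun x =>
      √(4 * d ^ 2 * localOsc (v n) (cellIndex (δ n) x))) atTop (𝓝 0) := by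
    intro D hD hDΩ
    have hlim : Tendsto (fun n => ENNReal.ofReal (4 * d ^ 2) * (C * ENNReal.ofReal (δ n ^ 2)))
        atTop (𝓝 0) := by
      have h1 := ENNReal.tendsto_ofReal (hδ0.pow 2)
      have h2 := ENNReal.Tendsto.const_mul (a := ENNReal.ofReal (4 * d ^ 2))
        (ENNReal.Tendsto.const_mul (a := (C : ℝ≥0∞)) h1 (by simp)) (Or.inr ENNReal.ofReal_ne_top)
      simpa using h2
    refine tendsto_of_tendsto_of_tendsto_of_le_of_le' tendsto_const_nhds hlim
      (Eventually.of_forall fun _ => zero_le) ?_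
    filter_upwards [hg.eventually_subset hΩ hD hDΩ] with n hn
    calc _ = ENNReal.ofReal (4 * d ^ 2) *
          ∫⁻ x in D, ENNReal.ofReal (localOsc (v n) (cellIndex (δ n) x)) := by
          rw [sqInt, ← lintegral_const_mul' _ _ ENNReal.ofReal_ne_top]
          refine lintegral_congr fun x => ?_
          rw [Real.sq_sqrt (mul_nonneg (by positivity) (localOsc_nonneg _ _)),
            ENNReal.ofReal_mul (by positivity)]
      _ ≤ _ := by
          gcongr
          exact (lintegral_mono_set hn).trans (hosc n)
  -- it suffices to bound the difference of the two sequences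
  have key : ∀ F G : ℕ → Euc d → ℝ, (∀ n x, (F n x - G n x) ^ 2 ≤
      4 * d ^ 2 * localOsc (v n) (cellIndex (δ n) x)) → TendstoL2Loc Ω G w →
      TendstoL2Loc Ω F w := by
    intro F G hFG hG D hD hDΩ
    obtain ⟨hwD, hlim⟩ := hG D hD hDΩ
    refine ⟨hwD, ?_⟩
    rw [tendsto_eLpNorm_two_iff] at hlim ⊢
    have hlim' : Tendsto (fun n => 2 * sqInt D (fun x =>
        √(4 * d ^ 2 * localOsc (v n) (cellIndex (δ n) x))) +
        2 * sqInt D (fun x => G n x - w x)) atTop (𝓝 0) := by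
      simpa using (ENNReal.Tendsto.const_mul (a := 2) (hdiff D hD hDΩ) (by simp)).add
        (ENNReal.Tendsto.const_mul (a := 2) hlim (by simp))
    refine tendsto_of_tendsto_of_tendsto_of_le_of_le tendsto_const_nhds hlim'
      (fun _ => zero_le) fun n => ?_
    -- The majorant of the difference depends only on the cell index, hence is measurable;
    -- measurability of `F n` is then not needed.
    have hm : Measurable fun x => √(4 * d ^ 2 * localOsc (v n) (cellIndex (δ n) x)) :=
      measurable_comp_cellIndex (δ n) fun k => √(4 * d ^ 2 * localOsc (v n) k)
    rw [sqInt, sqInt, sqInt, ← lintegral_const_mul _ (by fun_prop),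
      ← lintegral_const_mul' _ _ (by simp), ← lintegral_add_left (by fun_prop)]
    refine lintegral_mono fun x => ?_
    calc ENNReal.ofReal ((F n x - w x) ^ 2)
        = ENNReal.ofReal ((F n x - G n x + (G n x - w x)) ^ 2) := by rw [sub_add_sub_cancel]
      _ ≤ _ := ofReal_sq_add_le _ _
      _ ≤ _ := by
          gcongr 2 * ENNReal.ofReal ?_ + _
          rw [Real.sq_sqrt (mul_nonneg (by positivity) (localOsc_nonneg _ _))]
          exact hFG n x
  constructor
  · refine key _ _ fun n x => ?_
    rw [add_sub_add_right_eq_sub, sub_sq_comm]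
    exact sq_kuhnInterpolation_sub_le _ _ _
  · refine key _ _ fun n x => ?_
    rw [add_sub_add_right_eq_sub]
    exact sq_kuhnInterpolation_sub_le _ _ _

theorem memH1_of_tendstoL2Loc_kuhnInterpolation (hΩ : IsOpen Ω) (hbd : Bornology.IsBounded Ω)
    (hLip : HasLipschitzBoundary Ω) (hδ : ∀ n, 0 < δ n) (hδ0 : Tendsto δ atTop (𝓝 0))
    (hosc : ∀ n, ∫⁻ y in {y | Metric.ball y (R * δ n) ⊆ Ω},
      ENNReal.ofReal (localOsc (v n) (cellIndex (δ n) y)) ≤ C * ENNReal.ofReal (δ n ^ 2))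
    {c : ℕ → ℝ} {w : Euc d → ℝ}
    (hw : TendstoL2Loc Ω (fun n x => kuhnInterpolation (δ n) (v n) x + c n) w) : MemH1 Ω w := by
  rw [tendstoL2Loc_kuhnInterpolation_iff hΩ hδ hδ0 hosc] at hw
  exact (((shiftBounded_comp_cellIndex hδ hδ0 hosc).add_const c).shiftLipschitz hΩ hw).memH1 hΩ hbd
    hLip fun D hD hDΩ => (hw D hD hDΩ).1

theorem exists_tendstoL2Loc_kuhnInterpolation (hΩ : IsOpen Ω) (hc : IsConnected Ω)
    (hbd : Bornology.IsBounded Ω) (hδ : ∀ n, 0 < δ n) (hδ0 : Tendsto δ atTop (𝓝 0))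
    (hosc : ∀ n, ∫⁻ y in {y | Metric.ball y (R * δ n) ⊆ Ω},
      ENNReal.ofReal (localOsc (v n) (cellIndex (δ n) y)) ≤ C * ENNReal.ofReal (δ n ^ 2)) :
    ∃ (φ : ℕ → ℕ) (c : ℕ → ℝ) (w : Euc d → ℝ), StrictMono φ ∧
      TendstoL2Loc Ω (fun j x => kuhnInterpolation (δ (φ j)) (v (φ j)) x + c j) w := by
  obtain ⟨φ, c, w, hφ, hw⟩ := (shiftBounded_comp_cellIndex hδ hδ0 hosc).exists_tendstoL2Loc hΩ hc
    hbd fun n D hD => memLp_comp_cellIndex (hδ n) hD.isBounded (v n)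
  refine ⟨φ, c, w, hφ, (tendstoL2Loc_kuhnInterpolation_iff (δ := fun j => δ (φ j))
    (v := fun j => v (φ j)) hΩ (fun j => hδ _) (hδ0.comp hφ.tendsto_atTop)
    (fun j => hosc (φ j)) c w).2 hw⟩

/-- With `energy_congr_ae`, this allows `u` to be replaced by a Borel representative, as the
double-integral lemmas require. -/
theorem inclusionMean_congr_ae {u u' : Euc d → ℝ} {δ : ℝ} (h : u =ᵐ[volume.restrict Ω] u') :
    inclusionMean Ω K δ u = inclusionMean Ω K δ u' := by
  ext k
  unfold inclusionMean
  split_ifs with hk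
  · rw [integral_congr_ae (ae_restrict_of_ae_restrict_of_subset hk h)]
  · rfl

theorem energy_congr_ae {u u' : Euc d → ℝ} {φ₀ : ℝ≥0 → ℝ≥0} {δ ε : ℝ}
    (h : u =ᵐ[volume.restrict Ω] u') : energy Ω K φ₀ δ ε u = energy Ω K φ₀ δ ε u' := by
  unfold energy
  congr 1
  refine lintegral_congr_ae ?_
  rw [Measure.volume_eq_prod, ← Measure.prod_restrict]
  have h' := ae_restrict_of_ae_restrict_of_subset (s := Ω ∩ δ • periodicSet K)
    inter_subset_left h
  filter_upwards [Measure.quasiMeasurePreserving_fst.ae_eq_comp h',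
    Measure.quasiMeasurePreserving_snd.ae_eq_comp h'] with p h1 h2
  simp only [Function.comp_apply] at h1 h2
  rw [h1, h2]

/-- Under either assumption on the kernel there is a connectedness radius at which the kernel,
scaled by `κ`, is positive. -/
theorem exists_isConnected_and_pos (hd : 1 ≤ d) (hK : IsInclusionShape K) {φ₀ : ℝ≥0 → ℝ≥0}
    (hφ : Antitone φ₀) {κ : ℝ} (hκ : 0 < κ)
    (hsupp : (tsupport φ₀ = Icc 0 1 ∧ connectionDistance K < κ) ∨
      tsupport (radialKernel d φ₀) = univ) :
    ∃ (r ρ : ℝ) (s : ℝ≥0), 0 < r ∧ r < ρ ∧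
      IsConnected (periodicSet K + Metric.ball (0 : Euc d) (r / 2)) ∧ ρ < s * κ ∧ 0 < φ₀ s := by
  have hlarge := exists_isConnected_periodicSet_add_ball hK
  rcases hsupp with ⟨hsupp, hD⟩ | hsupp
  · obtain ⟨r, hr, hrκ⟩ := exists_lt_of_csInf_lt (hlarge.imp fun _ h => h.2) hD
    have hr' : IsConnected (periodicSet K + Metric.ball (0 : Euc d) (r / 2)) := hr
    have hr0 : 0 < r := by
      obtain ⟨-, -, -, y, hy, -⟩ := hr'.nonempty
      have := dist_nonneg.trans_lt (Metric.mem_ball.1 hy)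
      linarith
    -- With `ρ = (r + κ) / 2` there is room for `s < 1` with `ρ < s * κ`. As `1` lies in the closed
    -- support, `φ₀` is nonzero somewhere beyond `s`, and monotonicity gives `φ₀ s > 0`.
    have h1 : (r + κ) / 2 / κ < 1 := by rw [div_lt_one hκ]; linarith
    obtain ⟨s, hs, hs1⟩ := exists_between h1
    have hs0 : 0 < s := lt_trans (by positivity) hs
    lift s to ℝ≥0 using hs0.le
    refine ⟨r, (r + κ) / 2, s, hr0, by linarith, hr', (div_lt_iff₀ hκ).1 hs, ?_⟩
    have hmem : (1 : ℝ≥0) ∈ tsupport φ₀ := by rw [hsupp]; simp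
    obtain ⟨t, hts, ht⟩ := mem_closure_iff.1 hmem (Ioi s) isOpen_Ioi
      (by exact_mod_cast hs1)
    exact (pos_iff_ne_zero.2 ht).trans_le (hφ (le_of_lt hts))
  · obtain ⟨r, hr, hr'⟩ := hlarge
    set s : ℝ≥0 := ⟨2 * (r + 1) / κ, by positivity⟩ with hs
    have hsκ : (s : ℝ) * κ = 2 * (r + 1) := div_mul_cancel₀ _ hκ.ne'
    refine ⟨r, r + 1, s, hr, by linarith, hr', by rw [hsκ]; linarith, ?_⟩
    have : Nonempty (Fin d) := ⟨⟨0, hd⟩⟩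
    obtain ⟨ξ, hξ⟩ := NormedSpace.exists_lt_norm ℝ (Euc d) s
    have hmem : ξ ∈ tsupport (radialKernel d φ₀) := by rw [hsupp]; trivial
    obtain ⟨ξ', hξ', hne⟩ := mem_closure_iff.1 hmem {x | (s : ℝ) < ‖x‖}
      (isOpen_lt continuous_const continuous_norm) hξ
    have hne' : φ₀ ‖ξ'‖₊ ≠ 0 := fun h0 => hne (by simp [radialKernel, h0])
    refine (pos_iff_ne_zero.2 hne').trans_le (hφ ?_)
    rw [← NNReal.coe_le_coe, coe_nnnorm]
    exact le_of_lt hξ'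

/-- The averages of functions of bounded energy have oscillations of order `δ`. -/
theorem exists_eventually_lintegral_localOsc_le (hd : 1 ≤ d) (hΩ : IsOpen Ω)
    (hbd : Bornology.IsBounded Ω) (hK : IsInclusionShape K) {φ₀ : ℝ≥0 → ℝ≥0} (hφ : Antitone φ₀)
    {δ : ℝ → ℝ} (hδ : ∀ ε, 0 < ε → 0 < δ ε) {κ : ℝ} (hκ : 0 < κ)
    (hδκ : Tendsto (fun ε => ε / δ ε) (𝓝[>] 0) (𝓝 κ))
    (hsupp : (tsupport φ₀ = Icc 0 1 ∧ connectionDistance K < κ) ∨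
      tsupport (radialKernel d φ₀) = univ)
    {u : ℝ → Euc d → ℝ} (hu : ∀ ε, 0 < ε → MemLp (u ε) 2 (volume.restrict Ω))
    (hF : ∃ M : ℝ≥0, ∀ᶠ ε in 𝓝[>] 0, energy Ω K φ₀ (δ ε) ε (u ε) ≤ M) :
    ∃ (R : ℝ) (C : ℝ≥0), ∀ᶠ ε in 𝓝[>] 0, ∫⁻ y in {y | Metric.ball y (R * δ ε) ⊆ Ω},
      ENNReal.ofReal (localOsc (inclusionMean Ω K (δ ε) (u ε)) (cellIndex (δ ε) y)) ≤
        C * ENNReal.ofReal (δ ε ^ 2) := by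
  obtain ⟨r, ρ, s, hr, hrρ, hconn, hρ, hs⟩ := exists_isConnected_and_pos hd hK hφ hκ hsupp
  obtain ⟨C, R, hCR⟩ := exists_lintegral_localOsc_le (Ω := Ω) hK hr hrρ hconn
  obtain ⟨M, hM⟩ := hF
  have : IsFiniteMeasure (volume.restrict Ω) := ⟨by simpa using hbd.measure_lt_top⟩
  set X : ℝ≥0∞ := C * (ENNReal.ofReal ((2 * κ) ^ (d + 2)) * M / φ₀ s) with hX
  have hs' : (φ₀ s : ℝ≥0∞) ≠ 0 := by simpa using hs.ne'
  have hXt : X ≠ ∞ :=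
    ENNReal.mul_ne_top ENNReal.coe_ne_top (ENNReal.div_ne_top (by finiteness) hs')
  refine ⟨R, X.toNNReal, ?_⟩
  have hlim : Tendsto (fun ε => s * (ε / δ ε)) (𝓝[>] 0) (𝓝 (s * κ)) := hδκ.const_mul _
  -- For small `ε`, `ρ * δ < s * ε` makes the kernel at least `φ₀ s` at distances less than `ρ * δ`,
  -- and `ε ≤ 2 * κ * δ` turns `ε^(d+2)` into a multiple of `δ^(d+2)`. Cancelling `δ^d` leaves the
  -- required `δ²`.
  filter_upwards [hM, self_mem_nhdsWithin, hlim.eventually_const_lt hρ,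
    hδκ.eventually_le_const (by linarith : κ < 2 * κ)] with ε hMε hε hρε hκε
  have hε : 0 < ε := hε
  have hδε := hδ ε hε
  rw [div_le_iff₀ hδε] at hκε
  rw [← mul_div_assoc, lt_div_iff₀ hδε] at hρε
  have hui := hu ε hε
  set u' := hui.1.mk (u ε)
  have hae : u ε =ᵐ[volume.restrict Ω] u' := hui.1.ae_eq_mk
  have hu' : Measurable u' := hui.1.stronglyMeasurable_mk.measurable
  have hint : IntegrableOn u' Ω := (hui.integrable (by norm_num)).congr hae
  rw [inclusionMean_congr_ae hae]
  rw [energy_congr_ae hae] at hMε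
  have h1 := hCR (δ ε) hδε u' hu' hint
  have h2 := shortRangeEnergy_le (ρ := ρ) (δ := δ ε) hΩ hK (c := φ₀ s) hε (fun t ht => hφ (by
    have : (t : ℝ) * ε < s * ε := ht.trans hρε
    exact_mod_cast (lt_of_mul_lt_mul_right this hε.le).le)) u'
  set J := shortRangeEnergy Ω K ρ (δ ε) u'
  have h3 : J ≤ ENNReal.ofReal ((2 * κ) ^ (d + 2)) * M / φ₀ s * ENNReal.ofReal (δ ε ^ (d + 2)) := by
    rw [ENNReal.mul_comm_div, ← mul_div_assoc,
      ENNReal.le_div_iff_mul_le (Or.inl hs') (Or.inl ENNReal.coe_ne_top), mul_comm]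
    calc _ ≤ _ := h2
      _ ≤ ENNReal.ofReal ((2 * κ * δ ε) ^ (d + 2)) * M := by gcongr
      _ = _ := by
        rw [mul_pow, ENNReal.ofReal_mul (by positivity)]
        ring
  have hsd : ENNReal.ofReal (δ ε ^ d) ≠ 0 := by
    simp only [ne_eq, ENNReal.ofReal_eq_zero, not_le]; positivity
  rw [← ENNReal.mul_le_mul_iff_right hsd ENNReal.ofReal_ne_top, ENNReal.coe_toNNReal hXt]
  calc _ ≤ C * J := h1
    _ ≤ C * (ENNReal.ofReal ((2 * κ) ^ (d + 2)) * M / φ₀ s *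
        ENNReal.ofReal (δ ε ^ (d + 2))) := by gcongr
    _ = _ := by
      rw [hX, pow_add (δ ε), ENNReal.ofReal_mul (p := δ ε ^ d) (by positivity)]
      ring

end Interpolation

theorem theorem2p3 {d : ℕ} (hd : 1 ≤ d)
    (Ω : Set (EuclideanSpace ℝ (Fin d))) (hΩ_open : IsOpen Ω) (hΩ_conn : IsConnected Ω)
    (hΩ_bdd : Bornology.IsBounded Ω) (hΩ_lip : HasLipschitzBoundary Ω)
    (K : Set (EuclideanSpace ℝ (Fin d))) (hK : IsInclusionShape K)
    (φ₀ : ℝ≥0 → ℝ≥0) (hφ_anti : Antitone φ₀)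
    (hφ_int : Integrable fun ξ : EuclideanSpace ℝ (Fin d) => radialKernel d φ₀ ξ * (1 + ‖ξ‖ ^ 2))
    (δ : ℝ → ℝ) (hδ_pos : ∀ ε, 0 < ε → 0 < δ ε) (hδ : Tendsto δ (𝓝[>] 0) (𝓝 0))
    (κ : ℝ) (hκ_pos : 0 < κ) (hκ : Tendsto (fun ε => ε / δ ε) (𝓝[>] 0) (𝓝 κ))
    (hsupp : (tsupport φ₀ = Icc 0 1 ∧ connectionDistance K < κ) ∨
      tsupport (radialKernel d φ₀) = univ)
    (u : ℝ → EuclideanSpace ℝ (Fin d) → ℝ)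
    (hu : ∀ ε, 0 < ε → MemLp (u ε) 2 (volume.restrict Ω))
    (hF : ∃ M : ℝ≥0, ∀ᶠ ε in 𝓝[>] 0, energy Ω K φ₀ (δ ε) ε (u ε) ≤ M)
    (e : ℕ → ℝ) (he : Tendsto e atTop (𝓝[>] 0)) :
    (∃ (n : ℕ → ℕ) (c : ℕ → ℝ) (w : EuclideanSpace ℝ (Fin d) → ℝ), StrictMono n ∧ MemH1 Ω w ∧
      TendstoL2Loc Ω (fun j x => kuhnInterpolation (δ (e (n j)))
        (inclusionMean Ω K (δ (e (n j))) (u (e (n j)))) x + c j) w) ∧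
    (∀ (c : ℕ → ℝ) (w : EuclideanSpace ℝ (Fin d) → ℝ),
      TendstoL2Loc Ω (fun j x => kuhnInterpolation (δ (e j))
        (inclusionMean Ω K (δ (e j)) (u (e j))) x + c j) w → MemH1 Ω w) := by
  obtain ⟨R, C, hosc⟩ := exists_eventually_lintegral_localOsc_le hd hΩ_open hΩ_bdd hK hφ_anti hδ_pos
    hκ_pos hκ hsupp hu hF
  -- The bounds hold only for small `ε`, so both parts are proved for the sequence shifted by `N`.
  obtain ⟨N, hN⟩ := eventually_atTop.1 (he.eventually (hosc.and self_mem_nhdsWithin))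
  have hpos : ∀ n, 0 < δ (e (n + N)) := fun n => hδ_pos _ (hN (n + N) (Nat.le_add_left _ _)).2
  have hosc' := fun n => (hN (n + N) (Nat.le_add_left _ _)).1
  have hlim : Tendsto (fun n => δ (e (n + N))) atTop (𝓝 0) :=
    (hδ.comp he).comp (tendsto_add_atTop_nat N)
  constructor
  · obtain ⟨φ, c, w, hφ, hw⟩ := exists_tendstoL2Loc_kuhnInterpolation hΩ_open hΩ_conn hΩ_bdd hpos
      hlim hosc'
    refine ⟨fun j => φ j + N, c, w, hφ.add_const N, ?_, hw⟩
    exact memH1_of_tendstoL2Loc_kuhnInterpolation hΩ_open hΩ_bdd hΩ_lip (fun j => hpos (φ j))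
      (hlim.comp hφ.tendsto_atTop) (fun j => hosc' (φ j)) hw
  · intro c w hw
    refine memH1_of_tendstoL2Loc_kuhnInterpolation hΩ_open hΩ_bdd hΩ_lip hpos hlim hosc'
      (c := fun n => c (n + N)) fun D hD hDΩ => ?_
    exact ⟨(hw D hD hDΩ).1, (hw D hD hDΩ).2.comp (tendsto_add_atTop_nat N)⟩
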